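/- For a finite field $\mathbb{F}$, a $k$-pass randomized streaming algorithm with space $s$ reads the entries of a matrix $M\in\mathbb{F}^{n\times n}$ one at a time in row-major order, $k$ times in succession, keeping $s$ bits of memory between consecutive reads; the new memory contents are an arbitrary function of the old contents, the entry, its position, the pass number and a random seed (available throughout and not charged to the space), and the output is a function of the final memory contents and the seed. All logarithms are binary. (i) For nonnegative integers $r\ne R$ let $f_{r,R}\colon\mathbb{F}^{n\times n}\to\{-1,1,*\}$ be the partial function with $f_{r,R}(M)=-1$ if $\operatorname{rk}M=r$, $f_{r,R}(M)=1$ if $\operatorname{rk}M=R$, and $f_{r,R}(M)=*$ otherwise. A streaming algorithm computes $f_{r,R}$ with error $\epsilon$ if on every $M$ with $f_{r,R}(M)\ne *$ its output equals $f_{r,R}(M)$ with probability at least $1-\epsilon$. There is an absolute constant $c>0$ such that for all finite fields $\mathbb{F}$ and all nonnegative integers $n,r,R$ with $n/2\le r<R\le n$, every $k$-pass randomized streaming algorithm with space $s$ that computes $f_{r,R}$ with error $\frac12-\frac14|\mathbb{F}|^{-(r-\lceil n/2\rceil)/3}$ satisfies $$sk\ \ge\ c\,\Bigl(r-\Bigl\lceil\frac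 n2\Bigr\rceil\Bigr)^2\log|\mathbb{F}|.$$ (ii) For every $\delta\in(1/2,1)$ there is a constant $c_\delta>0$ such that for all finite fields $\mathbb{F}$ and all integers $n\ge\frac{5}{\delta-1/2}$, every $k$-pass randomized streaming algorithm with space $s$ that distinguishes the matrices $M\in\mathbb{F}^{n\times n}$ of rank $\lfloor\delta n\rfloor$ from those of rank $n$ with probability of correctness at least $\frac12+|\mathbb{F}|^{-(\delta-1/2)n/5}$ on each such matrix satisfies $sk\ge c_\delta\,n^2\log|\mathbb{F}|$. (iii) For every $a\in[1,\sqrt2)$ there is a constant $c_a>0$ such that for all finite fields $\mathbb{F}$ and all integers $n\ge\frac{40}{2-a^2}$, every $k$-pass randomized streaming algorithm with space $s$ that approximates the rank within a factor of $a$ with probability at least $\frac12+|\mathbb{F}|^{-(2-a^2)n/40}$ (that is, on every $M\in\mathbb{F}^{n\times n}$ its real-valued output lies in $[\frac1a\operatorname{rk}M,\,a\operatorname{rk}M]$ with at least this probability) satisfies $sk\ge c_a\,n^2\log|\mathbb{F}|$. -/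

import Mathlib

open MeasureTheory

universe u v w

/-- A deterministic `k`-pass streaming algorithm with `s` bits of memory, reading an `n × n` matrix
over `F` one entry at a time. The model is nonuniform: in pass `t`, on reading the entry in
position `(i, j)`, the new memory contents are an arbitrary function of `t`, `i`, `j`, the entry,
and the old memory contents. The output is a function of the final memory contents. -/
structure DetStreamAlg (F : Type*) (n k s : ℕ) (β : Type*) where
  init : Fin s → Bool
  step : Fin k → Fin n → Fin n → F → (Fin s → Bool) → (Fin s → Bool)
  output : (Fin s → Bool) → β

namespace DetStreamAlg

/-- The memory contents after pass `t` over `M` in row-major order, started from memory `σ`. -/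
def pass {F : Type*} {n k s : ℕ} {β : Type*} (A : DetStreamAlg F n k s β)
    (M : Matrix (Fin n) (Fin n) F) (σ : Fin s → Bool) (t : Fin k) : Fin s → Bool :=
  (List.finRange n).foldl
    (fun τ i => (List.finRange n).foldl (fun υ j => A.step t i j (M i j) υ) τ) σ

/-- The output after all `k` passes over `M`. -/
def run {F : Type*} {n k s : ℕ} {β : Type*} (A : DetStreamAlg F n k s β)
    (M : Matrix (Fin n) (Fin n) F) : β :=
  A.output ((List.finRange k).foldl (A.pass M) A.init)

end DetStreamAlg

/-- A randomized `k`-pass streaming algorithm with `s` bits of memory: a random choice of a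
deterministic one. The random seed `ω` lives on an arbitrary probability space, is available
throughout the computation, and is not charged to the memory. -/
structure RandStreamAlg (F : Type u) (n k s : ℕ) (β : Type v) [MeasurableSpace β] where
  Ω : Type w
  [mΩ : MeasurableSpace Ω]
  μ : Measure Ω
  [isProb : IsProbabilityMeasure μ]
  alg : Ω → DetStreamAlg F n k s β
  measurable_run : ∀ M : Matrix (Fin n) (Fin n) F, Measurable fun ω => (alg ω).run M

namespace RandStreamAlg

/-- The probability that the output on input `M` lies in `E`. -/
noncomputable def outputProb {F : Type*} {n k s : ℕ} {β : Type*} [MeasurableSpace β]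
    (A : RandStreamAlg F n k s β) (M : Matrix (Fin n) (Fin n) F) (E : Set β) : ℝ :=
  letI := A.mΩ
  A.μ.real {ω | (A.alg ω).run M ∈ E}

/-- `A` computes the partial function `f` with error `ε`: on every input in the domain of `f`
(where `f` is not `none`), the output agrees with `f` with probability at least `1 - ε`. -/
def ComputesWithError {F : Type*} {n k s : ℕ} (A : RandStreamAlg F n k s ℤˣ)
    (f : Matrix (Fin n) (Fin n) F → Option ℤˣ) (ε : ℝ) : Prop :=
  ∀ (M : Matrix (Fin n) (Fin n) F) (b : ℤˣ), f M = some b → 1 - ε ≤ A.outputProb M {b}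

/-- `A` approximates the rank within a factor of `c` with probability `p`: on every input `M`,
the output is in `[rk M / c, c * rk M]` with probability at least `p`. -/
def ApproximatesRank {F : Type*} [Field F] {n k s : ℕ} (A : RandStreamAlg F n k s ℝ)
    (c p : ℝ) : Prop :=
  ∀ M : Matrix (Fin n) (Fin n) F,
    p ≤ A.outputProb M (Set.Icc ((1 / c) * (M.rank : ℝ)) (c * (M.rank : ℝ)))

end RandStreamAlg

/-- The partial function that is `-1` on matrices of rank `r`, `1` on matrices of rank `R`, and
undefined on all other matrices. -/
noncomputable def rankProblem {F : Type*} [Field F] (n r R : ℕ) (M : Matrix (Fin n) (Fin n) F) : Option ℤˣ :=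
  if M.rank = r then some (-1) else if M.rank = R then some 1 else none

/-! The proof is a discrepancy argument for two-party communication, with a dual (witness) function
built from the Fourier analysis of matrix rank. Write `q` for the size of the field.

Reduction. Put `h = ⌈n/2⌉`, `N = R - h` and `ρ = r - h`, and let one player hold `A`, the other `B`,
both `N × N`. Suitable identity blocks give an `n × n` matrix whose first `N` rows depend only on
`A`, whose other rows depend only on `B`, and whose rank is `h + rk(A + B)` (`exists_split_matrix`).
A pass of the stream changes hands twice, so guessing all intermediate memories splits `k` passes
into `2 ^ (2sk)` rectangles. Hence the correlation of the output with any `Φ(A, B)` is at most `2 ^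
(2sk)` times the largest correlation of `Φ` with a rectangle.

Witness. Take `Φ(A, B) = φ(A + B)`, where `φ` spreads total mass `c m` evenly over the matrices of
rank `m`. By Parseval, its rectangle correlation is at most the number of matrices times the largest
Fourier coefficient of `φ`. At a matrix of rank `t` this coefficient is `∑ c m * rankChar q N t m`,
and `rankChar q N t m` is a polynomial of degree at most `t` in `q ^ (-m)`. Let `c` be the divided
difference on the nodes `q ^ (-m)` for `m` in `{0, …, d} ∪ {ρ, N}`, scaled so that `c ρ = -1`
(`exists_dual_coeff`). It annihilates all coefficients with `t ≤ d + 1`; for larger `t` the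
characters themselves are so small that `abs_sum_dual_mul_rankChar_le` gives `O(q ^ (-d(d+1)/2 -
ρ))`.

Conclusion. The mass of `c` on ranks at most `d` is `O(q ^ (-(ρ - d)))`. With `d = ⌊(ρ-1)/2⌋` this
spill is below the advantage `q ^ (-ρ/3) / 2` once `q ^ ρ` is large, so `2 ^ (2sk)` must make up for
a factor `q ^ (-Ω(ρ²))` (`advantage_le_of_rectangles`, `mul_sq_logb_le_of_advantage`). The
statements on `⌊δn⌋` against `n` and on approximation follow by choosing `r` with `r - h` linear in
`n`. -/

/-! ### Streaming algorithms as two-party protocols -/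

/-- A bound on the correlation of `Φ` with all combinatorial rectangles gives a bound on its
correlation with the final state of a two-party protocol that alternately updates a shared state. -/
theorem abs_sum_mul_foldl_le {X Y K S : Type*} [Fintype X] [Fintype Y] [Fintype S]
    (G : K → X → S → S) (H : K → Y → S → S) (Φ : X → Y → ℝ) (D : ℝ)
    (hD : ∀ (f : X → ℝ) (g : Y → ℝ), (∀ x, |f x| ≤ 1) → (∀ y, |g y| ≤ 1) →
      |∑ x, ∑ y, f x * g y * Φ x y| ≤ D)
    (out : S → ℝ) (hout : ∀ σ, |out σ| ≤ 1) (l : List K) :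
    ∀ (f : X → ℝ) (g : Y → ℝ) (σ : S), (∀ x, |f x| ≤ 1) → (∀ y, |g y| ≤ 1) →
      |∑ x, ∑ y, f x * g y * Φ x y * out (l.foldl (fun τ t => H t y (G t x τ)) σ)|
        ≤ ((Fintype.card S : ℝ) * Fintype.card S) ^ l.length * D := by
  classical
  induction l with
  | nil =>
    intro f g σ hf hg
    simp only [List.foldl_nil, List.length_nil, pow_zero, one_mul, ← Finset.sum_mul, abs_mul]
    calc _ ≤ |∑ x, ∑ y, f x * g y * Φ x y| * 1 := by gcongr; exact hout σ
      _ ≤ D := by rw [mul_one]; exact hD f g hf hg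
  | cons t l ih =>
    intro f g σ hf hg
    -- Guess the state `σ₁` after the first player's move and `σ₂` after the second's. For fixed
    -- guesses, correctness is a condition on `x` alone times a condition on `y` alone, so the
    -- indicators are absorbed into `f` and `g` and the induction hypothesis applies from `σ₂`.
    have key : ∀ x y, f x * g y * Φ x y * out ((t :: l).foldl (fun τ t => H t y (G t x τ)) σ)
        = ∑ σ₁, ∑ σ₂, (f x * if G t x σ = σ₁ then 1 else 0) *
          (g y * if H t y σ₁ = σ₂ then 1 else 0) * Φ x y *
            out (l.foldl (fun τ t => H t y (G t x τ)) σ₂) := by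
      intro x y
      rw [Finset.sum_eq_single (G t x σ), Finset.sum_eq_single (H t y (G t x σ))]
      · simp
      · intro b _ hb; simp [hb.symm]
      · simp
      · intro b _ hb; simp [hb.symm]
      · simp
    have key2 : ∑ x, ∑ y, f x * g y * Φ x y *
          out ((t :: l).foldl (fun τ t => H t y (G t x τ)) σ)
        = ∑ σ₁, ∑ σ₂, ∑ x, ∑ y, (f x * if G t x σ = σ₁ then 1 else 0) *
          (g y * if H t y σ₁ = σ₂ then 1 else 0) * Φ x y *
            out (l.foldl (fun τ t => H t y (G t x τ)) σ₂) := by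
      simp_rw [key]
      calc _ = ∑ x, ∑ σ₁, ∑ y, ∑ σ₂, _ := Finset.sum_congr rfl fun x _ => Finset.sum_comm
        _ = ∑ σ₁, ∑ x, ∑ y, ∑ σ₂, _ := Finset.sum_comm
        _ = ∑ σ₁, ∑ x, ∑ σ₂, ∑ y, _ := Finset.sum_congr rfl fun _ _ =>
            Finset.sum_congr rfl fun _ _ => Finset.sum_comm
        _ = _ := Finset.sum_congr rfl fun _ _ => Finset.sum_comm
    rw [key2]
    calc _ ≤ ∑ _σ₁ : S, ∑ _σ₂ : S, ((Fintype.card S : ℝ) * Fintype.card S) ^ l.length * D := by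
          refine (Finset.abs_sum_le_sum_abs _ _).trans (Finset.sum_le_sum fun σ₁ _ => ?_)
          refine (Finset.abs_sum_le_sum_abs _ _).trans (Finset.sum_le_sum fun σ₂ _ => ?_)
          refine ih _ _ σ₂ (fun x => ?_) (fun y => ?_)
          · split_ifs <;> simp [hf x]
          · split_ifs <;> simp [hg y]
      _ = _ := by
          simp only [Finset.sum_const, Finset.card_univ, nsmul_eq_mul, List.length_cons]
          ring

namespace DetStreamAlg

/-- One pass over a matrix whose first `p` rows come from `P` and whose other rows come from `Q`. -/
theorem pass_ite {F : Type*} {n k s : ℕ} {β : Type*} (A : DetStreamAlg F n k s β) (p : ℕ)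
    (P Q : Matrix (Fin n) (Fin n) F) (σ : Fin s → Bool) (t : Fin k) :
    A.pass (Matrix.of fun i j => if (i : ℕ) < p then P i j else Q i j) σ t =
      ((List.finRange n).drop p).foldl
        (fun τ i => (List.finRange n).foldl (fun υ j => A.step t i j (Q i j) υ) τ)
        (((List.finRange n).take p).foldl
          (fun τ i => (List.finRange n).foldl (fun υ j => A.step t i j (P i j) υ) τ) σ) := by
  rw [pass]
  conv_lhs => rw [← List.take_append_drop p (List.finRange n), List.foldl_append]
  rw [List.take_append_drop]
  have h1 : ∀ τ, ((List.finRange n).take p).foldl (fun τ i => (List.finRange n).foldl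
      (fun υ j => A.step t i j
        ((Matrix.of fun (i : Fin n) j => if (i : ℕ) < p then P i j else Q i j) i j) υ) τ) τ =
      ((List.finRange n).take p).foldl
        (fun τ i => (List.finRange n).foldl (fun υ j => A.step t i j (P i j) υ) τ) τ := by
    intro τ
    apply List.foldl_ext
    intro a i hi
    obtain ⟨m, hm, rfl⟩ := List.mem_take_iff_getElem.1 hi
    have hm' : m < p := (lt_min_iff.1 hm).1
    simp [hm']
  have h2 : ∀ τ, ((List.finRange n).drop p).foldl (fun τ i => (List.finRange n).foldl
      (fun υ j => A.step t i j
        ((Matrix.of fun (i : Fin n) j => if (i : ℕ) < p then P i j else Q i j) i j) υ) τ) τ =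
      ((List.finRange n).drop p).foldl
        (fun τ i => (List.finRange n).foldl (fun υ j => A.step t i j (Q i j) υ) τ) τ := by
    intro τ
    apply List.foldl_ext
    intro a i hi
    obtain ⟨m, hm, rfl⟩ := List.mem_drop_iff_getElem.1 hi
    simp
  rw [h1, h2]

/-- Correlation bound for a deterministic streaming algorithm on a matrix split between two
players. -/
theorem abs_sum_mul_run_le {F : Type*} {n k s : ℕ} {β : Type*} (A : DetStreamAlg F n k s β)
    {X Y : Type*} [Fintype X] [Fintype Y] (p : ℕ)
    (P : X → Matrix (Fin n) (Fin n) F) (Q : Y → Matrix (Fin n) (Fin n) F)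
    (Φ : X → Y → ℝ) (D : ℝ)
    (hD : ∀ (f : X → ℝ) (g : Y → ℝ), (∀ x, |f x| ≤ 1) → (∀ y, |g y| ≤ 1) →
      |∑ x, ∑ y, f x * g y * Φ x y| ≤ D)
    (out : β → ℝ) (hout : ∀ b, |out b| ≤ 1) :
    |∑ x, ∑ y, Φ x y *
      out (A.run (Matrix.of fun i j => if (i : ℕ) < p then P x i j else Q y i j))|
        ≤ 2 ^ (2 * (s * k)) * D := by
  have h := abs_sum_mul_foldl_le
    (G := fun t x σ => ((List.finRange n).take p).foldl
      (fun τ i => (List.finRange n).foldl (fun υ j => A.step t i j (P x i j) υ) τ) σ)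
    (H := fun t y σ => ((List.finRange n).drop p).foldl
      (fun τ i => (List.finRange n).foldl (fun υ j => A.step t i j (Q y i j) υ) τ) σ)
    Φ D hD (fun σ => out (A.output σ)) (fun σ => hout _) (List.finRange k)
    (fun _ => 1) (fun _ => 1) A.init (by simp) (by simp)
  have e : (((Fintype.card (Fin s → Bool) : ℕ) : ℝ) * (Fintype.card (Fin s → Bool) : ℕ)) ^
      (List.finRange k).length = 2 ^ (2 * (s * k)) := by
    simp only [Fintype.card_fun, Fintype.card_bool, Fintype.card_fin, List.length_finRange]
    push_cast
    rw [← pow_add, ← pow_mul]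
    congr 1
    ring
  rw [e] at h
  refine le_of_eq_of_le ?_ h
  congr 1
  refine Finset.sum_congr rfl fun x _ => Finset.sum_congr rfl fun y _ => ?_
  rw [one_mul, one_mul, run]
  congr 3
  apply List.foldl_ext
  intro a t _
  exact A.pass_ite p (P x) (Q y) a t

end DetStreamAlg

/-! ### Randomized algorithms as averages of deterministic ones -/

theorem Int.units_measurable_val : Measurable (fun b : ℤˣ => (b : ℤ)) :=
  comap_measurable _

theorem Int.units_measurableSet_singleton (b : ℤˣ) : MeasurableSet ({b} : Set ℤˣ) := by
  have : ({b} : Set ℤˣ) = (fun b : ℤˣ => (b : ℤ)) ⁻¹' {(b : ℤ)} := by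
    ext c; simp [Units.ext_iff]
  rw [this]
  exact Int.units_measurable_val (measurableSet_singleton _)

namespace RandStreamAlg

theorem outputProb_neg_one {F : Type*} {n k s : ℕ} (A : RandStreamAlg F n k s ℤˣ)
    (M : Matrix (Fin n) (Fin n) F) : A.outputProb M {-1} = 1 - A.outputProb M {1} := by
  let _ := A.mΩ
  have := A.isProb
  have hm : MeasurableSet {ω | (A.alg ω).run M ∈ ({1} : Set ℤˣ)} :=
    A.measurable_run M (Int.units_measurableSet_singleton 1)
  have h := probReal_compl_eq_one_sub (μ := A.μ) hm
  rw [outputProb, outputProb, ← h]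
  congr 1
  ext ω
  simp only [Set.mem_ofPred_eq, Set.mem_singleton_iff, Set.mem_compl_iff]
  rcases Int.units_eq_one_or ((A.alg ω).run M) with h | h <;> rw [h] <;> decide

/-- A sign has expectation `2 P(1) - 1`. This lets the correlation bound for each fixed seed be
integrated over the seed. -/
theorem integral_run {F : Type*} {n k s : ℕ} (A : RandStreamAlg F n k s ℤˣ)
    (M : Matrix (Fin n) (Fin n) F) :
    letI := A.mΩ
    Integrable (fun ω => (((A.alg ω).run M : ℤ) : ℝ)) A.μ ∧
    ∫ ω, (((A.alg ω).run M : ℤ) : ℝ) ∂A.μ = 2 * A.outputProb M {1} - 1 := by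
  let _ := A.mΩ
  have := A.isProb
  have hm : MeasurableSet {ω | (A.alg ω).run M ∈ ({1} : Set ℤˣ)} :=
    A.measurable_run M (Int.units_measurableSet_singleton 1)
  have e : (fun ω => (((A.alg ω).run M : ℤ) : ℝ)) =
      fun ω => 2 * ({ω | (A.alg ω).run M ∈ ({1} : Set ℤˣ)}.indicator 1 ω) - (1 : ℝ) := by
    ext ω
    rcases Int.units_eq_one_or ((A.alg ω).run M) with h | h
    · simp [Set.indicator, h]; norm_num
    · have : ¬ ((-1 : ℤˣ) = 1) := by decide
      simp [Set.indicator, h, this]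
  have hi : Integrable ({ω | (A.alg ω).run M ∈ ({1} : Set ℤˣ)}.indicator (1 : A.Ω → ℝ)) A.μ :=
    (integrable_const (1 : ℝ)).indicator hm
  rw [e]
  refine ⟨(hi.const_mul 2).sub (integrable_const _), ?_⟩
  rw [integral_sub (hi.const_mul 2) (integrable_const _), integral_const_mul,
    integral_indicator_one hm]
  simp [outputProb]

/-- Correlation bound for a randomized streaming algorithm on a matrix split between two
players. -/
theorem abs_sum_mul_outputProb_le {F : Type*} {n k s : ℕ} (A : RandStreamAlg F n k s ℤˣ)
    {X Y : Type*} [Fintype X] [Fintype Y] (p : ℕ)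
    (P : X → Matrix (Fin n) (Fin n) F) (Q : Y → Matrix (Fin n) (Fin n) F)
    (Φ : X → Y → ℝ) (D : ℝ)
    (hD : ∀ (f : X → ℝ) (g : Y → ℝ), (∀ x, |f x| ≤ 1) → (∀ y, |g y| ≤ 1) →
      |∑ x, ∑ y, f x * g y * Φ x y| ≤ D) :
    |∑ x, ∑ y, Φ x y * (2 * A.outputProb
      (Matrix.of fun i j => if (i : ℕ) < p then P x i j else Q y i j) {1} - 1)|
        ≤ 2 ^ (2 * (s * k)) * D := by
  let _ := A.mΩ
  have := A.isProb
  have e : ∑ x, ∑ y, Φ x y * (2 * A.outputProb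
      (Matrix.of fun i j => if (i : ℕ) < p then P x i j else Q y i j) {1} - 1) =
      ∫ ω, ∑ x, ∑ y, Φ x y * (((A.alg ω).run
        (Matrix.of fun i j => if (i : ℕ) < p then P x i j else Q y i j) : ℤ) : ℝ) ∂A.μ := by
    rw [integral_finsetSum _ fun x _ => integrable_finsetSum _ fun y _ =>
      ((A.integral_run _).1.const_mul _)]
    refine Finset.sum_congr rfl fun x _ => ?_
    rw [integral_finsetSum _ fun y _ => ((A.integral_run _).1.const_mul _)]
    refine Finset.sum_congr rfl fun y _ => ?_
    rw [integral_const_mul, (A.integral_run _).2]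
  rw [e, ← Real.norm_eq_abs]
  refine (norm_integral_le_of_norm_le_const (C := 2 ^ (2 * (s * k)) * D)
    (Filter.Eventually.of_forall fun ω => ?_)).trans (by simp)
  rw [Real.norm_eq_abs]
  refine (A.alg ω).abs_sum_mul_run_le p P Q Φ D hD (fun b => ((b : ℤ) : ℝ)) fun b => ?_
  rcases Int.units_eq_one_or b with h | h <;> simp [h]

/-- Without memory or without passes, the output does not depend on the input. -/
theorem outputProb_eq_of_mul_eq_zero {F : Type*} {n k s : ℕ} {β : Type*} [MeasurableSpace β]
    (A : RandStreamAlg F n k s β) (h : s * k = 0) (M M' : Matrix (Fin n) (Fin n) F) (E : Set β) :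
    A.outputProb M E = A.outputProb M' E := by
  have : ∀ ω, (A.alg ω).run M = (A.alg ω).run M' := by
    intro ω
    rcases Nat.mul_eq_zero.1 h with rfl | rfl
    · exact congrArg (A.alg ω).output (Subsingleton.elim (α := Fin 0 → Bool) _ _)
    · rfl
  simp only [outputProb, this]

end RandStreamAlg

/-! ### Fourier analysis on a finite abelian group and on matrices -/

section Fourier

/-- A bound on the Fourier transform of `φ` bounds the correlation of `(x, y) ↦ φ (x + y)` with all
combinatorial rectangles. -/
theorem abs_sum_mul_add_le {V : Type*} [Fintype V] [AddCommGroup V] (e : V → V → ℂ)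
    (hadd : ∀ x y B, e (x + y) B = e x B * e y B)
    (hconj : ∀ x B, (starRingEnd ℂ) (e x B) = e (-x) B)
    (horth : ∀ x, x ≠ 0 → ∑ B, e x B = 0) (hzero : ∀ B, e 0 B = 1)
    (φ : V → ℝ) (D : ℝ) (hφ : ∀ B, ‖∑ x, (φ x : ℂ) * e x B‖ ≤ D) (f g : V → ℝ)
    (hf : ∀ x, |f x| ≤ 1) (hg : ∀ x, |g x| ≤ 1) :
    |∑ x, ∑ y, f x * g y * φ (x + y)| ≤ Fintype.card V * D := by
  classical
  have horth' : ∀ x, ∑ B, e x B = if x = 0 then (Fintype.card V : ℂ) else 0 := by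
    intro x
    split_ifs with h
    · simp [h, hzero]
    · exact horth x h
  set ft : (V → ℝ) → V → ℂ := fun f B => ∑ x, (f x : ℂ) * e (-x) B with hft
  have hD : 0 ≤ D := (norm_nonneg _).trans (hφ 0)
  have parseval : ∀ f : V → ℝ, (∀ x, |f x| ≤ 1) →
      ∑ B, ‖ft f B‖ ^ 2 ≤ (Fintype.card V : ℝ) ^ 2 := by
    intro f hf
    have h1 : ((∑ B, ‖ft f B‖ ^ 2 : ℝ) : ℂ) = ((Fintype.card V * ∑ x, f x ^ 2 : ℝ) : ℂ) := by
      push_cast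
      calc ∑ B, (‖ft f B‖ : ℂ) ^ 2
          = ∑ B, ∑ x, ∑ y, (f x : ℂ) * f y * e (x - y) B := by
            refine Finset.sum_congr rfl fun B _ => ?_
            rw [← Complex.conj_mul', hft]
            simp only [map_sum, map_mul, Complex.conj_ofReal, hconj, neg_neg]
            rw [Finset.sum_mul_sum]
            refine Finset.sum_congr rfl fun x _ => Finset.sum_congr rfl fun y _ => ?_
            rw [sub_eq_add_neg, hadd]
            ring
        _ = ∑ x, ∑ y, (f x : ℂ) * f y * ∑ B, e (x - y) B := by
            simp only [Finset.mul_sum]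
            rw [Finset.sum_comm]
            exact Finset.sum_congr rfl fun x _ => Finset.sum_comm
        _ = _ := by
            simp only [horth', sub_eq_zero, mul_ite, mul_zero, Finset.sum_ite_eq,
              Finset.mem_univ, if_true, Finset.mul_sum]
            exact Finset.sum_congr rfl fun x _ => by ring
    have h2 : ∑ B, ‖ft f B‖ ^ 2 = Fintype.card V * ∑ x, f x ^ 2 := by exact_mod_cast h1
    rw [h2, pow_two]
    gcongr
    calc ∑ x, f x ^ 2 ≤ ∑ _x : V, (1 : ℝ) :=
          Finset.sum_le_sum fun x _ => (sq_le_one_iff_abs_le_one _).2 (hf x)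
      _ = _ := by simp
  -- A function of `x + y` is diagonalized by characters: up to the factor `card V`, the rectangle
  -- sum is the sum over `B` of the product of three Fourier transforms.
  have key : ((Fintype.card V * ∑ x, ∑ y, f x * g y * φ (x + y) : ℝ) : ℂ) =
      ∑ B, (∑ z, (φ z : ℂ) * e z B) * (ft f B * ft g B) := by
    symm
    calc ∑ B, (∑ z, (φ z : ℂ) * e z B) * (ft f B * ft g B)
        = ∑ B, ∑ x, ∑ y, ∑ z, (f x : ℂ) * g y * φ z * e (z - (x + y)) B := by
          refine Finset.sum_congr rfl fun B _ => ?_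
          rw [mul_comm, hft]
          simp only []
          rw [Finset.sum_mul_sum, Finset.sum_mul]
          refine Finset.sum_congr rfl fun x _ => ?_
          rw [Finset.sum_mul]
          refine Finset.sum_congr rfl fun y _ => ?_
          rw [Finset.mul_sum]
          refine Finset.sum_congr rfl fun z _ => ?_
          rw [sub_eq_add_neg, neg_add, hadd, hadd]
          ring
      _ = ∑ x, ∑ y, ∑ z, (f x : ℂ) * g y * φ z * ∑ B, e (z - (x + y)) B := by
          simp only [Finset.mul_sum]
          rw [Finset.sum_comm]
          refine Finset.sum_congr rfl fun x _ => ?_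
          rw [Finset.sum_comm]
          exact Finset.sum_congr rfl fun y _ => Finset.sum_comm
      _ = _ := by
          simp only [horth', sub_eq_zero, mul_ite, mul_zero, Finset.sum_ite_eq',
            Finset.mem_univ, if_true]
          push_cast
          simp only [Finset.mul_sum]
          exact Finset.sum_congr rfl fun x _ => Finset.sum_congr rfl fun y _ => by ring
  -- Bound the transform of `φ` by `D` and the product of the other two by AM-GM, then apply
  -- Parseval to each.
  have hle : |Fintype.card V * ∑ x, ∑ y, f x * g y * φ (x + y)| ≤
      D * (Fintype.card V : ℝ) ^ 2 := by
    rw [← Real.norm_eq_abs, ← Complex.norm_real, key]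
    calc _ ≤ ∑ B, D * ((‖ft f B‖ ^ 2 + ‖ft g B‖ ^ 2) / 2) := by
          refine (norm_sum_le _ _).trans (Finset.sum_le_sum fun B _ => ?_)
          rw [norm_mul, norm_mul]
          refine mul_le_mul (hφ B) ?_ (by positivity) hD
          nlinarith [sq_nonneg (‖ft f B‖ - ‖ft g B‖)]
      _ = D * ((∑ B, ‖ft f B‖ ^ 2 + ∑ B, ‖ft g B‖ ^ 2) / 2) := by
          rw [← Finset.mul_sum, ← Finset.sum_div, Finset.sum_add_distrib]
      _ ≤ _ := by
          refine mul_le_mul_of_nonneg_left ?_ hD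
          linarith [parseval f hf, parseval g hg]
  have hV : (0 : ℝ) < Fintype.card V := by exact_mod_cast Fintype.card_pos
  rw [abs_mul, abs_of_pos hV] at hle
  refine le_of_mul_le_mul_left (hle.trans (le_of_eq ?_)) hV
  ring

variable {F : Type*} [Field F] [Fintype F] {N : ℕ}

theorem AddChar.map_finset_sum {ι A M : Type*} [AddCommMonoid A] [CommMonoid M] (ψ : AddChar A M)
    (s : Finset ι) (f : ι → A) : ψ (∑ i ∈ s, f i) = ∏ i ∈ s, ψ (f i) :=
  map_prod ψ.toMonoidHom (fun i => Multiplicative.ofAdd (f i)) s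

/-- The sum of a nontrivial additive character over a line. -/
theorem AddChar.sum_mul_left (ψ : AddChar F ℂ) (hψ : ψ ≠ 1) [DecidableEq F] (y : F) :
    ∑ x, ψ (y * x) = if y = 0 then (Fintype.card F : ℂ) else 0 := by
  have h := AddChar.sum_mulShift y (AddChar.IsPrimitive.of_ne_one hψ)
  simp_rw [mul_comm y]
  rw [h]
  split_ifs <;> simp

/-- The character sum over the matrices whose columns in `S` vanish. -/
theorem sum_char_trace_mul (ψ : AddChar F ℂ) (hψ : ψ ≠ 1) (S : Fin N → Prop)
    (Y : Matrix (Fin N) (Fin N) F) (P : Matrix (Fin N) (Fin N) F → Prop) [DecidablePred P]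
    (hP : ∀ C, P C ↔ ∀ a, S a → ∀ b, C b a = 0) (Q : Prop) [Decidable Q]
    (hQ : Q ↔ ∀ a, ¬ S a → ∀ b, Y a b = 0) (d : ℕ) (hd : {a | ¬ S a}.ncard = d) :
    ∑ C : Matrix (Fin N) (Fin N) F, (if P C then ψ (Y * C).trace else 0) =
    if Q then (Fintype.card F : ℂ) ^ (N * d) else 0 := by
  classical
  -- The summand is a product over the entries of `C`, so the sum factors into one-variable sums:
  -- `1` for an entry forced to vanish, and `card F` or `0` for a free entry, by orthogonality of
  -- characters.
  have h1 : ∀ C : Matrix (Fin N) (Fin N) F,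
      (if P C then ψ (Y * C).trace else 0) =
      ∏ b, ∏ a, (if S a ∧ C b a ≠ 0 then 0 else ψ (Y a b * C b a)) := by
    intro C
    split_ifs with h
    · have : (Y * C).trace = ∑ b, ∑ a, Y a b * C b a := by
        simp only [Matrix.trace, Matrix.diag, Matrix.mul_apply]
        exact Finset.sum_comm
      rw [this, AddChar.map_finset_sum]
      refine Finset.prod_congr rfl fun b _ => ?_
      rw [AddChar.map_finset_sum]
      refine Finset.prod_congr rfl fun a _ => ?_
      rw [if_neg]
      rintro ⟨h1, h2⟩
      exact h2 ((hP C).1 h a h1 b)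
    · rw [hP] at h
      push Not at h
      obtain ⟨a, ha, b, hb⟩ := h
      symm
      refine Finset.prod_eq_zero (Finset.mem_univ b) (Finset.prod_eq_zero (Finset.mem_univ a) ?_)
      rw [if_pos ⟨ha, hb⟩]
  simp_rw [h1]
  have h2 : ∑ C : Matrix (Fin N) (Fin N) F,
      ∏ b, ∏ a, (if S a ∧ C b a ≠ 0 then 0 else ψ (Y a b * C b a)) =
      ∏ b, ∏ a, ∑ x : F, (if S a ∧ x ≠ 0 then 0 else ψ (Y a b * x)) := by
    simp_rw [Finset.prod_univ_sum, Fintype.piFinset_univ]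
    rfl
  rw [h2]
  have h3 : ∀ b a, ∑ x : F, (if S a ∧ x ≠ 0 then 0 else ψ (Y a b * x)) =
      if S a then 1 else if Y a b = 0 then (Fintype.card F : ℂ) else 0 := by
    intro b a
    by_cases hS : S a
    · simp only [hS, true_and, if_true]
      rw [Finset.sum_eq_single 0] <;> simp +contextual
    · simp only [hS, false_and, if_false]
      exact ψ.sum_mul_left hψ _
  simp_rw [h3]
  split_ifs with h
  · have : ∀ b a, (if S a then (1 : ℂ) else if Y a b = 0 then (Fintype.card F : ℂ) else 0) =
        if ¬ S a then (Fintype.card F : ℂ) else 1 := by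
      intro b a
      by_cases hS : S a
      · simp [hS]
      · simp [hS, hQ.1 h a hS b]
    simp_rw [this]
    simp only [Finset.prod_const, ← Finset.prod_filter]
    rw [Finset.card_univ, Fintype.card_fin, ← pow_mul, mul_comm, ← hd,
      Set.ncard_eq_toFinset_card', Set.toFinset_ofPred]
  · rw [hQ] at h
    push Not at h
    obtain ⟨a, ha, b, hb⟩ := h
    refine Finset.prod_eq_zero (Finset.mem_univ b) (Finset.prod_eq_zero (Finset.mem_univ a) ?_)
    simp [ha, hb]

theorem sum_char_trace_mul_eq_zero (ψ : AddChar F ℂ) (hψ : ψ ≠ 1)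
    (Y : Matrix (Fin N) (Fin N) F) (hY : Y ≠ 0) :
    ∑ C : Matrix (Fin N) (Fin N) F, ψ (Y * C).trace = 0 := by
  classical
  have h := sum_char_trace_mul ψ hψ (fun _ => False) Y (fun _ => True) (by simp) (Y = 0)
    (by simp [← Matrix.ext_iff]) _ rfl
  simpa [hY] using h

end Fourier

/-! ### Counting linearly independent families and invertible matrices -/

section Counting

variable {F : Type*} [Field F] [Fintype F]

/-- The polynomial `∏_{i < j} (x - q ^ i)`. -/
noncomputable def qFalling (q : ℝ) (j : ℕ) (x : ℝ) : ℝ := ∏ i ∈ Finset.range j, (x - q ^ i)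

/-- The product formula needs no restriction on `j`: beyond the dimension there are no independent
families, and the product contains a zero factor. -/
theorem card_linearIndependent_eq_qFalling (W : Type*) [AddCommGroup W] [Module F W]
    [Module.Finite F W] (j : ℕ) :
    (Nat.card {s : Fin j → W // LinearIndependent F s} : ℝ) =
      qFalling (Fintype.card F) j ((Fintype.card F : ℝ) ^ Module.finrank F W) := by
  rcases le_or_gt j (Module.finrank F W) with h | h
  · have : Finite W := Module.finite_of_finite F
    have := Fintype.ofFinite W
    rw [card_linearIndependent h, qFalling, Finset.prod_range]
    push_cast
    refine Finset.prod_congr rfl fun i _ => ?_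
    rw [Nat.cast_sub]
    · push_cast; rfl
    · exact Nat.pow_le_pow_right Fintype.card_pos (by omega)
  · have : IsEmpty {s : Fin j → W // LinearIndependent F s} := by
      refine ⟨fun s => ?_⟩
      have := s.2.fintype_card_le_finrank
      rw [Fintype.card_fin] at this
      omega
    rw [Nat.card_of_isEmpty, qFalling]
    symm
    push_cast
    exact Finset.prod_eq_zero (Finset.mem_range.2 h) (by simp)

/-- The general linear group acts transitively on linearly independent families. -/
theorem exists_GL_mulVec_eq {F : Type*} [Field F] {N : ℕ} {ι : Type*} {Z Z' : ι → Fin N → F}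
    (h : LinearIndependent F Z) (h' : LinearIndependent F Z') :
    ∃ g : GL (Fin N) F, ∀ i, (g : Matrix (Fin N) (Fin N) F).mulVec (Z i) = Z' i := by
  let f := (Module.Basis.span h).equiv (Module.Basis.span h') (Equiv.refl ι)
  obtain ⟨g, hg⟩ := Submodule.exists_linearEquiv_restrict_eq f
  refine ⟨⟨LinearMap.toMatrix' g.toLinearMap, LinearMap.toMatrix' g.symm.toLinearMap, ?_, ?_⟩,
    fun i => ?_⟩
  · rw [← LinearMap.toMatrix'_comp]; simp
  · rw [← LinearMap.toMatrix'_comp]; simp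
  · simp only [LinearMap.toMatrix'_mulVec]
    have h1 : (Z i) = (Module.Basis.span h i : Fin N → F) := congrArg Subtype.val (Module.Basis.span_apply h i).symm
    have h2 := hg (Module.Basis.span h i)
    rw [h1]
    refine Eq.trans h2.symm ?_
    rw [Module.Basis.equiv_apply]
    exact congrArg Subtype.val (Module.Basis.span_apply h' i)

open Classical in
/-- The number of invertible matrices whose columns in the range of `σ` lie in the kernel of `B`. -/
theorem card_GL_mul_col_eq_zero {N j : ℕ} (σ : Fin j ↪ Fin N) (B : Matrix (Fin N) (Fin N) F) :
    ((Finset.univ.filter fun g : GL (Fin N) F =>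
      ∀ i b, (B * (g : Matrix (Fin N) (Fin N) F)) b (σ i) = 0).card : ℝ) *
        qFalling (Fintype.card F) j ((Fintype.card F : ℝ) ^ N) =
      Fintype.card (GL (Fin N) F) *
        qFalling (Fintype.card F) j ((Fintype.card F : ℝ) ^ (N - B.rank)) := by
  let cols : GL (Fin N) F → (Fin j → Fin N → F) := fun g i =>
    (g : Matrix (Fin N) (Fin N) F).col (σ i)
  have hcols : ∀ g, LinearIndependent F (cols g) := fun g =>
    (Matrix.equiv_GL_linearindependent (𝔽 := F) N g).2.comp σ σ.injective
  have hmul : ∀ (g h : GL (Fin N) F) i, cols (h * g) i =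
      (h : Matrix (Fin N) (Fin N) F).mulVec (cols g i) := by
    intro g h i
    ext b
    simp [cols, Matrix.mul_apply, Matrix.mulVec, dotProduct]
  -- By transitivity, every independent `j`-tuple is the chosen set of columns of the same number
  -- `c` of invertible matrices. It remains to count the independent tuples inside the kernel of
  -- `B`.
  set c := (Finset.univ.filter fun g : GL (Fin N) F => cols g = cols 1).card with hc
  have hfib : ∀ Z : Fin j → Fin N → F, LinearIndependent F Z →
      (Finset.univ.filter fun g : GL (Fin N) F => cols g = Z).card = c := by
    intro Z hZ
    obtain ⟨h, hh⟩ := exists_GL_mulVec_eq hZ (hcols 1)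
    refine Finset.card_bij' (fun g _ => h * g) (fun g _ => h⁻¹ * g) ?_ ?_ (by simp) (by simp)
    · intro g hg
      simp only [Finset.mem_filter, Finset.mem_univ, true_and] at hg ⊢
      ext1 i
      rw [hmul, hg, hh]
    · intro g hg
      simp only [Finset.mem_filter, Finset.mem_univ, true_and] at hg ⊢
      ext1 i
      rw [hmul, hg, ← hh, Matrix.mulVec_mulVec]
      simp
  have hcount : ∀ B : Matrix (Fin N) (Fin N) F,
      ((Finset.univ.filter fun g : GL (Fin N) F =>
        ∀ i b, (B * (g : Matrix (Fin N) (Fin N) F)) b (σ i) = 0).card : ℝ) =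
      c * qFalling (Fintype.card F) j ((Fintype.card F : ℝ) ^ (N - B.rank)) := by
    intro B
    have h1 : (Finset.univ.filter fun g : GL (Fin N) F =>
        ∀ i b, (B * (g : Matrix (Fin N) (Fin N) F)) b (σ i) = 0).card =
        ∑ Z ∈ Finset.univ.filter (fun Z : Fin j → Fin N → F =>
          LinearIndependent F Z ∧ ∀ i, B.mulVec (Z i) = 0), c := by
      rw [Finset.card_eq_sum_card_fiberwise (f := cols)
        (t := Finset.univ.filter (fun Z : Fin j → Fin N → F =>
          LinearIndependent F Z ∧ ∀ i, B.mulVec (Z i) = 0))]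
      · refine Finset.sum_congr rfl fun Z hZ => ?_
        simp only [Finset.mem_filter, Finset.mem_univ, true_and] at hZ
        rw [← hfib Z hZ.1, Finset.filter_filter]
        congr 1
        ext g
        simp only [Finset.mem_filter, Finset.mem_univ, true_and, and_iff_right_iff_imp]
        rintro rfl i b
        exact congrFun (hZ.2 i) b
      · intro g hg
        simp only [Finset.coe_filter, Finset.mem_univ, true_and, Set.mem_ofPred_eq] at hg ⊢
        exact ⟨hcols g, fun i => funext fun b => hg i b⟩
    have h2 : (Finset.univ.filter (fun Z : Fin j → Fin N → F =>
          LinearIndependent F Z ∧ ∀ i, B.mulVec (Z i) = 0)).card =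
        Nat.card {s : Fin j → LinearMap.ker B.mulVecLin // LinearIndependent F s} := by
      rw [← Fintype.card_subtype, ← Nat.card_eq_fintype_card]
      refine Nat.card_congr ⟨fun Z => ⟨fun i => ⟨Z.1 i, by simpa using Z.2.2 i⟩, ?_⟩,
        fun s => ⟨fun i => (s.1 i : Fin N → F), ?_, fun i => ?_⟩, fun _ => rfl, fun _ => rfl⟩
      · exact LinearIndependent.of_comp (LinearMap.ker B.mulVecLin).subtype Z.2.1
      · exact s.2.map' (LinearMap.ker B.mulVecLin).subtype (Submodule.ker_subtype _)
      · exact LinearMap.mem_ker.1 (s.1 i).2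
    have h3 : Module.finrank F (LinearMap.ker B.mulVecLin) = N - B.rank := by
      have := B.mulVecLin.finrank_range_add_finrank_ker
      rw [Module.finrank_fintype_fun_eq_card, Fintype.card_fin] at this
      rw [Matrix.rank]
      omega
    rw [h1, Finset.sum_const, h2, smul_eq_mul, Nat.cast_mul, card_linearIndependent_eq_qFalling,
      h3, mul_comm]
  -- The case `B = 0` counts the whole group and so eliminates `c`.
  have h0 := hcount 0
  simp only [zero_mul, Matrix.zero_apply, implies_true, Finset.filter_true, Finset.card_univ,
    Matrix.rank_zero, Nat.sub_zero] at h0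
  rw [hcount B, h0]
  ring

end Counting

/-! ### Fourier transform of functions of the rank -/

section RankFourier

variable {F : Type*} [Field F] [Fintype F] {N : ℕ}

/-- The inverse transpose on the general linear group. -/
def Matrix.GeneralLinearGroup.invTranspose (g : GL (Fin N) F) : GL (Fin N) F where
  val := ((g⁻¹ : GL (Fin N) F) : Matrix (Fin N) (Fin N) F).transpose
  inv := (g : Matrix (Fin N) (Fin N) F).transpose
  val_inv := by rw [← Matrix.transpose_mul]; simp
  inv_val := by rw [← Matrix.transpose_mul]; simp

omit [Fintype F] in
theorem Matrix.GeneralLinearGroup.invTranspose_involutive :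
    Function.Involutive (Matrix.GeneralLinearGroup.invTranspose (F := F) (N := N)) := by
  intro g
  ext1
  rfl

theorem qFalling_pow_ne_zero {q : ℝ} (hq : 1 < q) {j n : ℕ} (h : j ≤ n) :
    qFalling q j (q ^ n) ≠ 0 := by
  refine Finset.prod_ne_zero_iff.2 fun i hi => ?_
  have := Finset.mem_range.1 hi
  exact (sub_pos.2 (pow_lt_pow_right₀ hq (by omega))).ne'

theorem qFalling_pow_eq_zero {q : ℝ} {j n : ℕ} (h : n < j) : qFalling q j (q ^ n) = 0 :=
  Finset.prod_eq_zero (Finset.mem_range.2 h) (sub_self _)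

theorem one_lt_card_real : (1 : ℝ) < Fintype.card F := by exact_mod_cast Fintype.one_lt_card

open Classical in
/-- The Fourier transform of a `q`-falling factorial of the size of the kernel. -/
theorem sum_qFalling_rank_mul_char (ψ : AddChar F ℂ) (hψ : ψ ≠ 1) {j : ℕ} (hj : j ≤ N)
    (A : Matrix (Fin N) (Fin N) F) :
    ∑ B : Matrix (Fin N) (Fin N) F,
      (qFalling (Fintype.card F) j ((Fintype.card F : ℝ) ^ (N - B.rank)) : ℂ) *
        ψ (A * B).trace =
    (((Fintype.card F : ℝ) ^ (N * (N - j)) *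
      qFalling (Fintype.card F) j ((Fintype.card F : ℝ) ^ N) *
      (qFalling (Fintype.card F) (N - j) ((Fintype.card F : ℝ) ^ (N - A.rank)) /
        qFalling (Fintype.card F) (N - j) ((Fintype.card F : ℝ) ^ N)) : ℝ) : ℂ) := by
  set q : ℝ := (Fintype.card F : ℝ) with hq
  have hq1 : 1 < q := one_lt_card_real
  set G : ℝ := (Fintype.card (GL (Fin N) F) : ℝ) with hG
  have hG0 : G ≠ 0 := by
    rw [hG]; exact_mod_cast Fintype.card_ne_zero
  let σ : Fin j ↪ Fin N := Fin.castLEEmb hj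
  let τ : Fin (N - j) ↪ Fin N :=
    ⟨fun i => ⟨j + i, by omega⟩, fun a b h => by simpa [Fin.ext_iff] using h⟩
  have hτ : ∀ i, (τ i : ℕ) = j + i := fun _ => rfl
  -- Up to a constant, the `q`-falling factorial of the kernel size is a sum over `g` of indicators
  -- of the linear subspaces on which the first `j` columns of `B * g` vanish. The transform of such
  -- an indicator is a multiple of the indicator of the annihilator, on which the last `N - j` rows
  -- of `g⁻¹ * A` vanish; `hcount2` counts these `g` after an inverse transpose.
  have hcount1 : ∀ B : Matrix (Fin N) (Fin N) F,
      ((Finset.univ.filter fun g : GL (Fin N) F => ∀ a : Fin N, (a : ℕ) < j → ∀ b,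
        (B * (g : Matrix (Fin N) (Fin N) F)) b a = 0).card : ℝ) * qFalling q j (q ^ N) =
      G * qFalling q j (q ^ (N - B.rank)) := by
    intro B
    rw [← card_GL_mul_col_eq_zero σ B]
    congr 3
    ext g
    simp only [Finset.mem_filter, Finset.mem_univ, true_and]
    exact ⟨fun h i b => h _ i.2 b, fun h a ha b => h ⟨a, ha⟩ b⟩
  have hcount2 : ((Finset.univ.filter fun g : GL (Fin N) F => ∀ a : Fin N, ¬ (a : ℕ) < j → ∀ b,
        (((g⁻¹ : GL (Fin N) F) : Matrix (Fin N) (Fin N) F) * A) a b = 0).card : ℝ) *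
          qFalling q (N - j) (q ^ N) = G * qFalling q (N - j) (q ^ (N - A.rank)) := by
    rw [← Matrix.rank_transpose A, ← card_GL_mul_col_eq_zero τ A.transpose]
    congr 2
    refine Finset.card_equiv Matrix.GeneralLinearGroup.invTranspose_involutive.toPerm fun g => ?_
    simp only [Finset.mem_filter, Finset.mem_univ, true_and, Function.Involutive.coe_toPerm]
    have h : ∀ a b, (A.transpose * (Matrix.GeneralLinearGroup.invTranspose g :
        Matrix (Fin N) (Fin N) F)) b a =
        (((g⁻¹ : GL (Fin N) F) : Matrix (Fin N) (Fin N) F) * A) a b := by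
      intro a b
      rw [← Matrix.transpose_apply (((g⁻¹ : GL (Fin N) F) : Matrix (Fin N) (Fin N) F) * A),
        Matrix.transpose_mul]
      rfl
    simp_rw [h]
    constructor
    · intro h i b
      exact h _ (by rw [hτ]; omega) b
    · intro h a ha b
      have := h ⟨(a : ℕ) - j, by omega⟩ b
      convert this using 2
      exact Fin.ext (Nat.add_sub_cancel' (not_lt.1 ha)).symm
  have hF1 := qFalling_pow_ne_zero hq1 hj
  have hF2 := qFalling_pow_ne_zero hq1 (Nat.sub_le N j)
  have hcard : {a : Fin N | ¬ (a : ℕ) < j}.ncard = N - j := by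
    have h := Finset.card_filter_add_card_filter_not (s := Finset.univ)
      (fun a : Fin N => (a : ℕ) < j)
    rw [Fin.card_filter_val_lt, Finset.card_univ, Fintype.card_fin] at h
    rw [Set.ncard_eq_toFinset_card', Set.toFinset_ofPred]
    omega
  have main : ∑ B : Matrix (Fin N) (Fin N) F, ((Finset.univ.filter fun g : GL (Fin N) F =>
      ∀ a : Fin N, (a : ℕ) < j → ∀ b, (B * (g : Matrix (Fin N) (Fin N) F)) b a = 0).card : ℂ) *
        ψ (A * B).trace = (q : ℂ) ^ (N * (N - j)) *
      ((Finset.univ.filter fun g : GL (Fin N) F => ∀ a : Fin N, ¬ (a : ℕ) < j → ∀ b,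
        (((g⁻¹ : GL (Fin N) F) : Matrix (Fin N) (Fin N) F) * A) a b = 0).card : ℂ) := by
    simp only [Finset.card_filter, Nat.cast_sum, Finset.sum_mul, Finset.mul_sum]
    rw [Finset.sum_comm]
    refine Finset.sum_congr rfl fun g _ => ?_
    have h := sum_char_trace_mul ψ hψ (fun a : Fin N => (a : ℕ) < j)
      (((g⁻¹ : GL (Fin N) F) : Matrix (Fin N) (Fin N) F) * A)
      (fun C => ∀ a : Fin N, (a : ℕ) < j → ∀ b, C b a = 0) (fun _ => Iff.rfl)
      (∀ a : Fin N, ¬ (a : ℕ) < j → ∀ b,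
        (((g⁻¹ : GL (Fin N) F) : Matrix (Fin N) (Fin N) F) * A) a b = 0) Iff.rfl (N - j) hcard
    have hQ : (q : ℂ) ^ (N * (N - j)) * ((if ∀ a : Fin N, ¬ (a : ℕ) < j → ∀ b,
        (((g⁻¹ : GL (Fin N) F) : Matrix (Fin N) (Fin N) F) * A) a b = 0 then 1 else 0 : ℕ) : ℂ) =
        if ∀ a : Fin N, ¬ (a : ℕ) < j → ∀ b,
        (((g⁻¹ : GL (Fin N) F) : Matrix (Fin N) (Fin N) F) * A) a b = 0 then
          (Fintype.card F : ℂ) ^ (N * (N - j)) else 0 := by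
      split_ifs <;> simp [hq]
    -- Substitute `B = C * g⁻¹`; cyclicity of the trace moves `g⁻¹` in front of `A`.
    rw [hQ, ← h, ← Equiv.sum_comp (Units.mulRight (g⁻¹ : GL (Fin N) F))]
    refine Finset.sum_congr rfl fun C _ => ?_
    have hC : Units.mulRight (g⁻¹ : GL (Fin N) F) C * (g : Matrix (Fin N) (Fin N) F) = C := by
      rw [Units.mulRight_apply, Matrix.mul_assoc C, Units.inv_mul, Matrix.mul_one]
    have htr : (A * Units.mulRight (g⁻¹ : GL (Fin N) F) C).trace =
        (((g⁻¹ : GL (Fin N) F) : Matrix (Fin N) (Fin N) F) * A * C).trace := by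
      rw [Units.mulRight_apply, ← Matrix.mul_assoc A, Matrix.trace_mul_comm, ← Matrix.mul_assoc]
    rw [htr]
    by_cases hc : ∀ a : Fin N, (a : ℕ) < j → ∀ b, C b a = 0
    · rw [if_pos hc, if_pos (by rw [hC]; exact hc), Nat.cast_one, one_mul]
    · rw [if_neg hc, if_neg (by rw [hC]; exact hc), Nat.cast_zero, zero_mul]
  have e1 : ∀ B : Matrix (Fin N) (Fin N) F, qFalling q j (q ^ (N - B.rank)) =
      ((Finset.univ.filter fun g : GL (Fin N) F =>
      ∀ a : Fin N, (a : ℕ) < j → ∀ b, (B * (g : Matrix (Fin N) (Fin N) F)) b a = 0).card : ℝ) *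
        (qFalling q j (q ^ N) / G) := by
    intro B
    rw [← mul_div_assoc, hcount1, mul_div_cancel_left₀ _ hG0]
  have e2 : qFalling q (N - j) (q ^ (N - A.rank)) / qFalling q (N - j) (q ^ N) =
      ((Finset.univ.filter fun g : GL (Fin N) F => ∀ a : Fin N, ¬ (a : ℕ) < j → ∀ b,
        (((g⁻¹ : GL (Fin N) F) : Matrix (Fin N) (Fin N) F) * A) a b = 0).card : ℝ) / G := by
    rw [div_eq_div_iff hF2 hG0, hcount2, mul_comm]
  rw [e2]
  simp only [e1, Complex.ofReal_mul, Complex.ofReal_div, Complex.ofReal_natCast,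
    Complex.ofReal_pow]
  calc _ = (∑ B : Matrix (Fin N) (Fin N) F, ((Finset.univ.filter fun g : GL (Fin N) F =>
      ∀ a : Fin N, (a : ℕ) < j → ∀ b, (B * (g : Matrix (Fin N) (Fin N) F)) b a = 0).card : ℂ) *
        ψ (A * B).trace) * ((qFalling q j (q ^ N) : ℂ) / G) := by
        rw [Finset.sum_mul]
        exact Finset.sum_congr rfl fun B _ => by ring
    _ = _ := by
        rw [main]
        ring

/-! ### Newton interpolation at powers of `q` -/

/-- The sum telescopes: adding the term of index `n + 1` multiplies the product by its next factor.
At `x = q ^ m` the right side is `1` for `m = 0` and vanishes for `1 ≤ m ≤ n`, so this is a Newton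
expansion of an indicator. -/
theorem sum_qFalling_div_prod {q : ℝ} (hq : 1 < q) (x : ℝ) (n : ℕ) :
    ∑ w ∈ Finset.range (n + 1), qFalling q w x / ∏ i ∈ Finset.range w, (1 - q ^ (i + 1)) =
      ∏ i ∈ Finset.range n, ((x - q ^ (i + 1)) / (1 - q ^ (i + 1))) := by
  have hne : ∀ i : ℕ, (1 : ℝ) - q ^ (i + 1) ≠ 0 := fun i =>
    (sub_neg.2 (one_lt_pow₀ hq (Nat.succ_ne_zero i))).ne
  have hprod : ∀ n : ℕ, ∏ i ∈ Finset.range n, (1 - q ^ (i + 1)) ≠ 0 := fun n =>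
    Finset.prod_ne_zero_iff.2 fun i _ => hne i
  induction n with
  | zero => simp [qFalling]
  | succ n ih =>
    rw [Finset.sum_range_succ, ih, Finset.prod_div_distrib, Finset.prod_div_distrib, qFalling,
      Finset.prod_range_succ' (fun i => x - q ^ i), Finset.prod_range_succ,
      Finset.prod_range_succ (fun i => x - q ^ (i + 1))]
    field_simp [hprod n, hne n]
    ring

theorem qFalling_add (q : ℝ) (c w : ℕ) (x : ℝ) :
    qFalling q (c + w) x = qFalling q c x * ∏ i ∈ Finset.range w, (x - q ^ (c + i)) :=
  Finset.prod_range_add _ _ _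

theorem qFalling_add_pow (q : ℝ) (c w k : ℕ) :
    qFalling q (c + w) (q ^ (c + k)) =
      qFalling q c (q ^ (c + k)) * (q ^ (c * w) * qFalling q w (q ^ k)) := by
  rw [qFalling_add]
  congr 1
  have h : ∀ i, q ^ (c + k) - q ^ (c + i) = q ^ c * (q ^ k - q ^ i) := fun i => by ring
  simp_rw [h, Finset.prod_mul_distrib, Finset.prod_const, Finset.card_range]
  rw [pow_mul, qFalling]

end RankFourier

/-! ### Eigenvalues of the bilinear forms scheme -/

section RankCharacters

/-- The signed Gaussian binomial weight `(-1) ^ w q ^ (w choose 2) [t choose w]_q`. -/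
noncomputable def qWeight (q : ℝ) (t w : ℕ) : ℝ :=
  qFalling q w (q ^ t) / ∏ i ∈ Finset.range w, (1 - q ^ (i + 1))

/-- The normalized eigenvalue of the bilinear forms scheme: the average of the character indexed by
a matrix of rank `m` over all `N × N` matrices of rank `t`. -/
noncomputable def rankChar (q : ℝ) (N t m : ℕ) : ℝ :=
  (∑ w ∈ Finset.range (t + 1), qWeight q t w *
    (q ^ (N * (t - w)) * (qFalling q (t - w) (q ^ (N - m)) / qFalling q (t - w) (q ^ N)))) /
      qFalling q t (q ^ N)

theorem prod_one_sub_pow_ne_zero {q : ℝ} (hq : 1 < q) (w : ℕ) :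
    ∏ i ∈ Finset.range w, (1 - q ^ (i + 1)) ≠ 0 :=
  Finset.prod_ne_zero_iff.2 fun i _ => (sub_neg.2 (one_lt_pow₀ hq (Nat.succ_ne_zero i))).ne

/-- The `q`-binomial theorem. -/
theorem sum_qWeight_mul_pow {q : ℝ} (hq : 1 < q) (t : ℕ) (x : ℝ) :
    ∑ w ∈ Finset.range (t + 1), qWeight q t w * x ^ (t - w) = qFalling q t x := by
  have hne : ∀ i : ℕ, (1 : ℝ) - q ^ (i + 1) ≠ 0 := fun i =>
    (sub_neg.2 (one_lt_pow₀ hq (Nat.succ_ne_zero i))).ne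
  -- This `q`-Pascal rule is comparison of coefficients in `qFalling q (t + 1) x = (x - q ^ t) *
  -- qFalling q t x`.
  have hrec : ∀ t w, qWeight q (t + 1) (w + 1) = qWeight q t (w + 1) - q ^ t * qWeight q t w := by
    intro t w
    have h1 : qFalling q (w + 1) (q ^ (t + 1)) =
        (q ^ (t + 1) - 1) * (q ^ w * qFalling q w (q ^ t)) := by
      have := qFalling_add_pow q 1 w t
      rw [add_comm 1 w, add_comm 1 t] at this
      rw [this, one_mul]
      simp [qFalling]
    have h2 : qFalling q (w + 1) (q ^ t) = qFalling q w (q ^ t) * (q ^ t - q ^ w) :=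
      Finset.prod_range_succ _ _
    rw [qWeight, qWeight, qWeight, h1, h2, Finset.prod_range_succ]
    have := prod_one_sub_pow_ne_zero hq w
    have := hne w
    field_simp
    ring
  have hlast : ∀ t, qWeight q t (t + 1) = 0 := fun t => by
    rw [qWeight, qFalling_pow_eq_zero (Nat.lt_succ_self t), zero_div]
  have hzero : ∀ t, qWeight q t 0 = 1 := fun t => by simp [qWeight, qFalling]
  induction t with
  | zero => simp [qWeight, qFalling]
  | succ t ih =>
    have h1 : ∑ w ∈ Finset.range (t + 1), qWeight q t (w + 1) * x ^ (t - w) +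
        x ^ (t + 1) = x * ∑ w ∈ Finset.range (t + 1), qWeight q t w * x ^ (t - w) := by
      have h3 : ∑ w ∈ Finset.range (t + 2), qWeight q t w * x ^ (t + 1 - w) =
          x * ∑ w ∈ Finset.range (t + 1), qWeight q t w * x ^ (t - w) := by
        rw [Finset.sum_range_succ, hlast, zero_mul, add_zero, Finset.mul_sum]
        refine Finset.sum_congr rfl fun w hw => ?_
        have hw' := Finset.mem_range.1 hw
        rw [show t + 1 - w = (t - w) + 1 by omega]
        ring
      rw [← h3, Finset.sum_range_succ' _ (t + 1), hzero]
      simp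
    rw [Finset.sum_range_succ']
    simp only [hrec, sub_mul, Finset.sum_sub_distrib, Nat.add_sub_add_right, hzero, one_mul,
      Nat.sub_zero]
    rw [sub_add_eq_add_sub, h1, ih]
    simp only [mul_assoc]
    rw [← Finset.mul_sum, ih, qFalling, qFalling, Finset.prod_range_succ]
    ring

/-- Newton interpolation of the indicator of `k = t`. -/
theorem ite_eq_sum_qFalling {q : ℝ} (hq : 1 < q) {N k t : ℕ} (hk : k ≤ N) (ht : t ≤ N) :
    (if k = t then (1 : ℝ) else 0) = ∑ w ∈ Finset.range (t + 1),
      ((qFalling q (N - t) (q ^ (N - t)) * q ^ ((N - t) * w) *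
        ∏ i ∈ Finset.range w, (1 - q ^ (i + 1)))⁻¹) * qFalling q (N - t + w) (q ^ (N - k)) := by
  rcases lt_or_ge t k with h | h
  · rw [if_neg (by omega)]
    refine (Finset.sum_eq_zero fun w _ => ?_).symm
    rw [qFalling_pow_eq_zero (show N - k < N - t + w by omega), mul_zero]
  · obtain ⟨m, rfl⟩ := Nat.exists_eq_add_of_le h
    have hN : N - k = (N - (k + m)) + m := by omega
    have hq0 : q ≠ 0 := by positivity
    -- With `t = k + m`, the common factor `qFalling q (N - t)` splits off from every term. What
    -- remains is the Newton expansion at `q ^ m`, which singles out `m = 0`.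
    have h1 := qFalling_pow_ne_zero hq (le_refl (N - (k + m)))
    calc _ = qFalling q (N - (k + m)) (q ^ (N - (k + m) + m)) /
          qFalling q (N - (k + m)) (q ^ (N - (k + m))) *
          ∏ i ∈ Finset.range (k + m), ((q ^ m - q ^ (i + 1)) / (1 - q ^ (i + 1))) := by
          rcases Nat.eq_zero_or_pos m with rfl | hm
          · rw [if_pos (Nat.add_zero k).symm, Nat.add_zero (N - (k + 0)), div_self h1, Finset.prod_eq_one, one_mul]
            intro i _
            rw [pow_zero, div_self]
            exact (sub_neg.2 (one_lt_pow₀ hq (Nat.succ_ne_zero i))).ne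
          · rw [if_neg (by omega), Finset.prod_eq_zero (i := m - 1), mul_zero]
            · exact Finset.mem_range.2 (by omega)
            · rw [Nat.sub_add_cancel hm, sub_self, zero_div]
      _ = _ := by
          rw [← sum_qFalling_div_prod hq, Finset.mul_sum]
          refine Finset.sum_congr rfl fun w _ => ?_
          rw [hN, qFalling_add_pow]
          have h2 := prod_one_sub_pow_ne_zero hq w
          have h3 : q ^ ((N - (k + m)) * w) ≠ 0 := pow_ne_zero _ hq0
          field_simp

variable {F : Type*} [Field F] [Fintype F] {N : ℕ}

open Classical in
/-- The number of `N × N` matrices of rank `t`. -/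
noncomputable def numRank (F : Type*) [Field F] [Fintype F] (N t : ℕ) : ℝ :=
  ((Finset.univ.filter fun B : Matrix (Fin N) (Fin N) F => B.rank = t).card : ℝ)

omit [Fintype F] in
theorem Matrix.rank_le_fin (A : Matrix (Fin N) (Fin N) F) : A.rank ≤ N := A.rank_le_width

-- Newton interpolation writes the indicator of rank `t` as a combination of `q`-falling factorials
-- of the kernel size, whose transforms are known. The value at `A = 0` then identifies the
-- prefactor with the number of matrices of rank `t`.
open Classical in
theorem sum_rank_eq_char (ψ : AddChar F ℂ) (hψ : ψ ≠ 1) {t : ℕ} (ht : t ≤ N)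
    (A : Matrix (Fin N) (Fin N) F) :
    ∑ B : Matrix (Fin N) (Fin N) F, (if B.rank = t then ψ (A * B).trace else 0) =
      ((numRank F N t * rankChar (Fintype.card F) N t A.rank : ℝ) : ℂ) ∧ 0 < numRank F N t := by
  set q : ℝ := (Fintype.card F : ℝ) with hq
  have hq1 : 1 < q := one_lt_card_real
  have hq0 : q ≠ 0 := by positivity
  -- The Gaussian binomial counting the possible kernels, of dimension `N - t`; each kernel is
  -- shared by `qFalling q t (q ^ N)` matrices.
  set p : ℝ := qFalling q (N - t) (q ^ N) / qFalling q (N - t) (q ^ (N - t)) with hp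
  have hp0 : p ≠ 0 := div_ne_zero (qFalling_pow_ne_zero hq1 (Nat.sub_le N t))
    (qFalling_pow_ne_zero hq1 le_rfl)
  have hFt := qFalling_pow_ne_zero hq1 ht
  have h1 : ∀ A : Matrix (Fin N) (Fin N) F,
      ∑ B : Matrix (Fin N) (Fin N) F, (if B.rank = t then ψ (A * B).trace else 0) =
      ((p * qFalling q t (q ^ N) * rankChar q N t A.rank : ℝ) : ℂ) := by
    intro A
    have e : ∀ B : Matrix (Fin N) (Fin N) F, (if B.rank = t then ψ (A * B).trace else 0) =
        ∑ w ∈ Finset.range (t + 1),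
        (((qFalling q (N - t) (q ^ (N - t)) * q ^ ((N - t) * w) *
        ∏ i ∈ Finset.range w, (1 - q ^ (i + 1)))⁻¹ : ℝ) : ℂ) *
          ((qFalling q (N - t + w) (q ^ (N - B.rank)) : ℂ) * ψ (A * B).trace) := by
      intro B
      have h := ite_eq_sum_qFalling hq1 B.rank_le_fin ht
      have h' := congrArg (fun x : ℝ => (x : ℂ) * ψ (A * B).trace) h
      simp only [Complex.ofReal_sum, Complex.ofReal_mul, Finset.sum_mul, mul_assoc] at h' ⊢
      rw [← h']
      split_ifs <;> simp
    simp_rw [e]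
    rw [Finset.sum_comm]
    simp_rw [← Finset.mul_sum]
    rw [rankChar, mul_assoc, mul_div_cancel₀ _ hFt, Finset.mul_sum, Complex.ofReal_sum]
    refine Finset.sum_congr rfl fun w hw => ?_
    have hw' : w ≤ t := Nat.lt_succ_iff.1 (Finset.mem_range.1 hw)
    rw [sum_qFalling_rank_mul_char ψ hψ (by omega) A, ← Complex.ofReal_mul]
    congr 1
    have e1 : N - (N - t + w) = t - w := by omega
    have e2 : qFalling q (N - t + w) (q ^ N) =
        qFalling q (N - t) (q ^ N) * (q ^ ((N - t) * w) * qFalling q w (q ^ t)) := by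
      have := qFalling_add_pow q (N - t) w t
      rwa [Nat.sub_add_cancel ht] at this
    rw [e1, e2, hp, qWeight]
    have h2 := prod_one_sub_pow_ne_zero hq1 w
    have h3 : q ^ ((N - t) * w) ≠ 0 := pow_ne_zero _ hq0
    have h4 := qFalling_pow_ne_zero hq1 (le_refl (N - t))
    have h5 := qFalling_pow_ne_zero hq1 ((Nat.sub_le t w).trans ht)
    rw [← hq]
    field_simp
  have h0 : numRank F N t = p * qFalling q t (q ^ N) := by
    have h := h1 0
    have h2 : rankChar q N t 0 = 1 := by
      rw [rankChar, div_eq_one_iff_eq hFt, ← sum_qWeight_mul_pow hq1]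
      refine Finset.sum_congr rfl fun w _ => ?_
      rw [Nat.sub_zero, div_self (qFalling_pow_ne_zero hq1 ((Nat.sub_le t w).trans ht)), mul_one,
        pow_mul]
    rw [Matrix.rank_zero, h2, mul_one] at h
    have h3 : (numRank F N t : ℂ) = ((p * qFalling q t (q ^ N) : ℝ) : ℂ) := by
      rw [← h, numRank, Finset.card_filter]
      push_cast
      refine Finset.sum_congr rfl fun B _ => ?_
      split_ifs <;> simp
    exact_mod_cast h3
  refine ⟨by rw [h1, h0], lt_of_le_of_ne (Nat.cast_nonneg _) ?_⟩
  rw [h0]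
  exact (mul_ne_zero hp0 hFt).symm

open Classical in
theorem sum_rank_fiber {M : Type*} [AddCommMonoid M] (f : Matrix (Fin N) (Fin N) F → M) :
    ∑ A, f A = ∑ m ∈ Finset.range (N + 1), ∑ A, if A.rank = m then f A else 0 := by
  rw [Finset.sum_comm]
  refine Finset.sum_congr rfl fun A _ => ?_
  rw [Finset.sum_ite_eq, if_pos (Finset.mem_range.2 (Nat.lt_succ_of_le A.rank_le_fin))]

/-- The Fourier transform of the function that spreads mass `c m` evenly over the matrices of
rank `m`. -/
theorem sum_rank_function_mul_char (ψ : AddChar F ℂ) (hψ : ψ ≠ 1) (c : ℕ → ℝ)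
    (B : Matrix (Fin N) (Fin N) F) :
    ∑ A : Matrix (Fin N) (Fin N) F, ((c A.rank / numRank F N A.rank : ℝ) : ℂ) * ψ (A * B).trace =
      ((∑ m ∈ Finset.range (N + 1), c m * rankChar (Fintype.card F) N B.rank m : ℝ) : ℂ) := by
  classical
  set q : ℝ := (Fintype.card F : ℝ) with hq
  have h1 : ∀ B : Matrix (Fin N) (Fin N) F,
      ∑ A : Matrix (Fin N) (Fin N) F,
        ((c A.rank / numRank F N A.rank : ℝ) : ℂ) * ψ (A * B).trace =
      ((∑ m ∈ Finset.range (N + 1), c m * rankChar q N m B.rank : ℝ) : ℂ) := by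
    intro B
    rw [sum_rank_fiber, Complex.ofReal_sum]
    refine Finset.sum_congr rfl fun m hm => ?_
    have hm' : m ≤ N := Nat.lt_succ_iff.1 (Finset.mem_range.1 hm)
    obtain ⟨h2, h3⟩ := sum_rank_eq_char ψ hψ hm' B
    calc _ = ((c m / numRank F N m : ℝ) : ℂ) *
          ∑ A : Matrix (Fin N) (Fin N) F, (if A.rank = m then ψ (B * A).trace else 0) := by
          rw [Finset.mul_sum]
          refine Finset.sum_congr rfl fun A _ => ?_
          split_ifs with h
          · rw [h, Matrix.trace_mul_comm]
          · rw [mul_zero]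
      _ = _ := by
          rw [h2, ← Complex.ofReal_mul]
          congr 1
          rw [← hq]
          field_simp
  set t := B.rank with ht
  obtain ⟨-, hpos⟩ := sum_rank_eq_char ψ hψ B.rank_le_fin B
  -- Self-duality of the scheme. The direct computation `h1` puts the rank `t` of `B` in the second
  -- argument of `rankChar`; summing over all `B'` of rank `t` and exchanging sums moves it to the
  -- first. There it bounds the degree of a polynomial in `q ^ (-m)`.
  have h2 : (numRank F N t : ℂ) * ((∑ m ∈ Finset.range (N + 1), c m * rankChar q N m t : ℝ) : ℂ) =
      (numRank F N t : ℂ) * ((∑ m ∈ Finset.range (N + 1), c m * rankChar q N t m : ℝ) : ℂ) := by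
    calc _ = ∑ B' : Matrix (Fin N) (Fin N) F, if B'.rank = t then
          ∑ A : Matrix (Fin N) (Fin N) F,
            ((c A.rank / numRank F N A.rank : ℝ) : ℂ) * ψ (A * B').trace else 0 := by
          rw [numRank, Finset.card_filter]
          push_cast
          rw [Finset.sum_mul]
          refine Finset.sum_congr rfl fun B' _ => ?_
          split_ifs with h
          · have h1' := h1 B'
            rw [h] at h1'
            push_cast at h1'
            rw [h1']; simp
          · simp
      _ = ∑ A : Matrix (Fin N) (Fin N) F, ((c A.rank / numRank F N A.rank : ℝ) : ℂ) *
          ((numRank F N t * rankChar q N t A.rank : ℝ) : ℂ) := by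
          have hs : ∀ A : Matrix (Fin N) (Fin N) F,
              ((numRank F N t * rankChar q N t A.rank : ℝ) : ℂ) =
              ∑ B' : Matrix (Fin N) (Fin N) F, if B'.rank = t then ψ (A * B').trace else 0 :=
            fun A => (sum_rank_eq_char ψ hψ B.rank_le_fin A).1.symm
          simp_rw [hs, Finset.mul_sum]
          rw [Finset.sum_comm]
          refine Finset.sum_congr rfl fun B' _ => ?_
          split_ifs with h
          · rfl
          · simp
      _ = _ := by
          rw [sum_rank_fiber, Complex.ofReal_sum, Finset.mul_sum]
          refine Finset.sum_congr rfl fun m hm => ?_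
          have hm' : m ≤ N := Nat.lt_succ_iff.1 (Finset.mem_range.1 hm)
          obtain ⟨-, h3⟩ := sum_rank_eq_char ψ hψ hm' B
          have e : ∀ A : Matrix (Fin N) (Fin N) F, (if A.rank = m then
              ((c A.rank / numRank F N A.rank : ℝ) : ℂ) *
              ((numRank F N t * rankChar q N t A.rank : ℝ) : ℂ) else 0) =
              (if A.rank = m then 1 else 0) * (((c m / numRank F N m : ℝ) : ℂ) *
              ((numRank F N t * rankChar q N t m : ℝ) : ℂ)) := by
            intro A
            split_ifs with h
            · rw [h, one_mul]
            · rw [zero_mul]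
          simp_rw [e]
          rw [← Finset.sum_mul, Finset.sum_boole, ← Complex.ofReal_natCast, ← numRank,
            ← Complex.ofReal_mul, ← Complex.ofReal_mul, ← Complex.ofReal_mul]
          congr 1
          field_simp
  rw [h1 B]
  exact mul_left_cancel₀ (by exact_mod_cast hpos.ne') h2

end RankCharacters

/-! ### Size of the rank characters -/

section Bounds

/-- The triangular numbers. -/
def triangular (n : ℕ) : ℕ := ∑ i ∈ Finset.range n, (i + 1)

theorem two_mul_triangular (n : ℕ) : 2 * triangular n = n * (n + 1) := by
  induction n with
  | zero => rfl
  | succ n ih => rw [triangular, Finset.sum_range_succ, mul_add, ← triangular, ih]; ring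

theorem prod_pow_succ_eq (y : ℝ) (n : ℕ) :
    ∏ i ∈ Finset.range n, y ^ (i + 1) = y ^ triangular n :=
  Finset.prod_pow_eq_pow_sum _ _ _

/-- The induction carries the surplus `ε = 2 ^ (-(n+2))`: since `ε ≤ 1/4`, one has `(1/4 + ε)(1 - ε)
≥ 1/4 + ε/2`. -/
theorem quarter_le_prod_one_sub_pow {y : ℝ} (h0 : 0 ≤ y) (h1 : y ≤ 1 / 2) (n : ℕ) :
    1 / 4 ≤ ∏ i ∈ Finset.range n, (1 - y ^ (i + 1)) := by
  have key : ∀ n : ℕ, 1 / 4 + (1 / 2 : ℝ) ^ (n + 2) ≤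
      ∏ i ∈ Finset.range (n + 1), (1 - y ^ (i + 1)) := by
    intro n
    induction n with
    | zero => simp; linarith
    | succ n ih =>
      rw [Finset.prod_range_succ]
      have h2 : y ^ (n + 2) ≤ (1 / 2) ^ (n + 2) := pow_le_pow_left₀ h0 h1 _
      have h3 : (1 / 2 : ℝ) ^ (n + 2) ≤ 1 / 4 := by
        calc (1 / 2 : ℝ) ^ (n + 2) ≤ (1 / 2) ^ 2 :=
              pow_le_pow_of_le_one (by norm_num) (by norm_num) (by omega)
          _ = 1 / 4 := by norm_num
      have h4 : (0 : ℝ) < (1 / 2) ^ (n + 2) := by positivity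
      calc 1 / 4 + (1 / 2 : ℝ) ^ (n + 1 + 2)
          ≤ (1 / 4 + (1 / 2 : ℝ) ^ (n + 2)) * (1 - (1 / 2) ^ (n + 2)) := by
            rw [show n + 1 + 2 = (n + 2) + 1 by ring, pow_succ _ (n + 2)]
            nlinarith
        _ ≤ _ := by
            refine mul_le_mul ih (by linarith) (by linarith) ?_
            exact (by positivity : (0 : ℝ) ≤ 1 / 4 + (1 / 2) ^ (n + 2)).trans ih
  cases n with
  | zero => norm_num
  | succ n =>
    have : (0 : ℝ) < (1 / 2) ^ (n + 2) := by positivity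
    linarith [key n]

theorem sum_range_pow_le_two {y : ℝ} (h0 : 0 ≤ y) (h1 : y ≤ 1 / 2) (n : ℕ) :
    ∑ i ∈ Finset.range n, y ^ i ≤ 2 := by
  have : ∑ i ∈ Finset.range n, y ^ i ≤ 2 - (1 / 2) ^ n * 2 := by
    induction n with
    | zero => simp
    | succ n ih =>
      rw [Finset.sum_range_succ, pow_succ]
      have := pow_le_pow_left₀ h0 h1 n
      linarith
  have h : (0 : ℝ) ≤ (1 / 2) ^ n * 2 := by positivity
  linarith

/-- Two geometric series, one on each side of the minimum of the exponent, each contribute at most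
`2`. Below `m` the growth is counted from `m - 1`, because the exponents met later take their
minimum at both `m - 1` and `m`. -/
theorem sum_range_pow_le {y : ℝ} (h0 : 0 ≤ y) (h1 : y ≤ 1 / 2) (n m E : ℕ) (e : ℕ → ℕ)
    (he1 : ∀ k, m + k < n → E + k ≤ e (m + k))
    (he2 : ∀ w k, w < n → m = w + 1 + k → E + k ≤ e w) :
    ∑ w ∈ Finset.range n, y ^ e w ≤ 4 * y ^ E := by
  have hy : y ≤ 1 := by linarith
  set g : ℕ → ℝ := fun w => if m ≤ w then y ^ (w - m) else y ^ (m - 1 - w) with hg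
  have hg0 : ∀ w, 0 ≤ g w := fun w => by simp only [hg]; split_ifs <;> positivity
  calc ∑ w ∈ Finset.range n, y ^ e w ≤ ∑ w ∈ Finset.range n, y ^ E * g w := by
        refine Finset.sum_le_sum fun w hw => ?_
        have hw' := Finset.mem_range.1 hw
        simp only [hg]
        split_ifs with h
        · obtain ⟨k, rfl⟩ := Nat.exists_eq_add_of_le h
          rw [← pow_add]
          exact pow_le_pow_of_le_one h0 hy (by simpa using he1 k hw')
        · rw [← pow_add]
          exact pow_le_pow_of_le_one h0 hy (he2 w _ hw' (by omega))
    _ = y ^ E * ∑ w ∈ Finset.range n, g w := by rw [Finset.mul_sum]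
    _ ≤ y ^ E * 4 := by
        refine mul_le_mul_of_nonneg_left ?_ (by positivity)
        calc ∑ w ∈ Finset.range n, g w ≤ ∑ w ∈ Finset.range (m + n), g w :=
              Finset.sum_le_sum_of_subset_of_nonneg
                (Finset.range_subset_range.2 (Nat.le_add_left n m)) fun w _ _ => hg0 w
          _ = ∑ w ∈ Finset.range m, y ^ (m - 1 - w) + ∑ w ∈ Finset.range n, y ^ w := by
              rw [Finset.sum_range_add]
              congr 1
              · refine Finset.sum_congr rfl fun w hw => ?_
                have := Finset.mem_range.1 hw
                simp only [hg]
                rw [if_neg (by omega)]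
              · simp [hg]
          _ ≤ 2 + 2 := by
              rw [Finset.sum_range_reflect (fun w => y ^ w)]
              exact add_le_add (sum_range_pow_le_two h0 h1 m) (sum_range_pow_le_two h0 h1 n)
          _ = 4 := by norm_num
    _ = _ := mul_comm _ _

variable {q : ℝ}

theorem qFalling_pow_pos (hq : 2 ≤ q) {j n : ℕ} (h : j ≤ n) : 0 < qFalling q j (q ^ n) := by
  refine Finset.prod_pos fun i hi => ?_
  have := Finset.mem_range.1 hi
  exact sub_pos.2 (pow_lt_pow_right₀ (by linarith) (by omega))

theorem inv_le_half (hq : 2 ≤ q) : q⁻¹ ≤ 1 / 2 := by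
  rw [one_div]; exact inv_anti₀ (by norm_num) hq

theorem abs_qWeight_le (hq : 2 ≤ q) {t w : ℕ} (hw : w ≤ t) :
    |qWeight q t w| ≤ 4 * (q ^ (t * w) * q⁻¹ ^ triangular w) := by
  have hq0 : 0 < q := by linarith
  have hy : (0 : ℝ) ≤ q⁻¹ := by positivity
  have hE := quarter_le_prod_one_sub_pow hy (inv_le_half hq) w
  have hden : |∏ i ∈ Finset.range w, (1 - q ^ (i + 1))| =
      (q⁻¹ ^ triangular w)⁻¹ * ∏ i ∈ Finset.range w, (1 - q⁻¹ ^ (i + 1)) := by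
    rw [Finset.abs_prod, ← prod_pow_succ_eq, ← Finset.prod_inv_distrib, ← Finset.prod_mul_distrib]
    refine Finset.prod_congr rfl fun i _ => ?_
    have : 1 ≤ q ^ (i + 1) := one_le_pow₀ (by linarith)
    rw [abs_of_nonpos (by linarith), inv_pow, inv_inv, mul_sub, mul_inv_cancel₀ (by positivity)]
    ring
  have hnum : qFalling q w (q ^ t) ≤ q ^ (t * w) := by
    rw [pow_mul, qFalling]
    calc ∏ i ∈ Finset.range w, (q ^ t - q ^ i) ≤ ∏ _i ∈ Finset.range w, q ^ t := by
          refine Finset.prod_le_prod (fun i hi => ?_) fun i _ => ?_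
          · have := Finset.mem_range.1 hi
            exact sub_nonneg.2 (pow_le_pow_right₀ (by linarith) (by omega))
          · linarith [pow_pos hq0 i]
      _ = _ := by simp
  rw [qWeight, abs_div, hden, abs_of_pos (qFalling_pow_pos hq hw), div_le_iff₀ (by positivity)]
  have hT : 0 < q⁻¹ ^ triangular w := by positivity
  calc qFalling q w (q ^ t) ≤ q ^ (t * w) := hnum
    _ = 4 * q ^ (t * w) * (1 / 4) := by ring
    _ ≤ 4 * q ^ (t * w) * ∏ i ∈ Finset.range w, (1 - q⁻¹ ^ (i + 1)) := by gcongr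
    _ = _ := by field_simp

/-- If `j > N - m` the numerator vanishes; otherwise compare factor by factor, `q ^ (N - m) - q ^ i
≤ q ^ (-m) * (q ^ N - q ^ i)`. -/
theorem abs_qFalling_div_le (hq : 2 ≤ q) {N m j : ℕ} (hm : m ≤ N) (hj : j ≤ N) :
    |qFalling q j (q ^ (N - m)) / qFalling q j (q ^ N)| ≤ q⁻¹ ^ (m * j) := by
  have hq0 : 0 < q := by linarith
  rcases lt_or_ge (N - m) j with h | h
  · rw [qFalling_pow_eq_zero h, zero_div, abs_zero]; positivity
  · rw [abs_of_pos (div_pos (qFalling_pow_pos hq h) (qFalling_pow_pos hq hj)),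
      div_le_iff₀ (qFalling_pow_pos hq hj)]
    have e : q⁻¹ ^ (m * j) * qFalling q j (q ^ N) =
        ∏ i ∈ Finset.range j, (q⁻¹ ^ m * (q ^ N - q ^ i)) := by
      rw [Finset.prod_mul_distrib, Finset.prod_const, Finset.card_range, pow_mul, qFalling]
    rw [e]
    refine Finset.prod_le_prod (fun i hi => ?_) fun i _ => ?_
    · have := Finset.mem_range.1 hi
      exact sub_nonneg.2 (pow_le_pow_right₀ (by linarith) (by omega))
    · have h1 : q ^ (N - m) = q⁻¹ ^ m * q ^ N := by
        rw [inv_pow, ← div_eq_inv_mul, eq_div_iff (by positivity), ← pow_add,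
          Nat.sub_add_cancel hm]
      have h2 : q⁻¹ ^ m * q ^ i ≤ q ^ i :=
        mul_le_of_le_one_left (by positivity)
          (pow_le_one₀ (by positivity) ((inv_le_half hq).trans (by norm_num)))
      rw [h1, mul_sub]
      linarith

/-- Extracting `q ^ N` from each factor leaves factors `1 - q ^ (-(N - i))`, which `t ≤ N` compares
with an Euler product of length `t`. -/
theorem qFalling_pow_ge (hq : 2 ≤ q) {N t : ℕ} (ht : t ≤ N) :
    q ^ (N * t) / 4 ≤ qFalling q t (q ^ N) := by
  have hq0 : 0 < q := by linarith
  have hy : (0 : ℝ) ≤ q⁻¹ := by positivity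
  have hy1 : q⁻¹ ≤ 1 := (inv_le_half hq).trans (by norm_num)
  have hE := quarter_le_prod_one_sub_pow hy (inv_le_half hq) t
  rw [← Finset.prod_range_reflect] at hE
  calc q ^ (N * t) / 4 = q ^ (N * t) * (1 / 4) := by ring
    _ ≤ q ^ (N * t) * ∏ j ∈ Finset.range t, (1 - q⁻¹ ^ (t - 1 - j + 1)) := by gcongr
    _ = ∏ j ∈ Finset.range t, (q ^ N * (1 - q⁻¹ ^ (t - 1 - j + 1))) := by
        rw [Finset.prod_mul_distrib, Finset.prod_const, Finset.card_range, pow_mul]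
    _ ≤ _ := by
        refine Finset.prod_le_prod (fun i _ => ?_) fun i hi => ?_
        · have := pow_le_one₀ (n := t - 1 - i + 1) hy hy1
          exact mul_nonneg (by positivity) (by linarith)
        · have hi' := Finset.mem_range.1 hi
          have h1 : q ^ i = q ^ N * q⁻¹ ^ (N - i) := by
            rw [inv_pow, ← div_eq_mul_inv, eq_div_iff (by positivity), ← pow_add,
              Nat.add_sub_cancel' (by omega)]
          have h2 : q⁻¹ ^ (N - i) ≤ q⁻¹ ^ (t - 1 - i + 1) :=
            pow_le_pow_of_le_one hy hy1 (by omega)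
          rw [h1, mul_sub, mul_one]
          gcongr

/-- The triangle inequality, term by term. One factor `4` comes from the weights and one from the
denominator; the positive powers of `q` cancel because `t * w + N * (t - w) ≤ N * t`. -/
theorem abs_rankChar_le (hq : 2 ≤ q) {N t m : ℕ} (ht : t ≤ N) (hm : m ≤ N) :
    |rankChar q N t m| ≤
      16 * ∑ w ∈ Finset.range (t + 1), q⁻¹ ^ (triangular w + m * (t - w)) := by
  have hq0 : 0 < q := by linarith
  rw [rankChar, abs_div, abs_of_pos (qFalling_pow_pos hq ht), div_le_iff₀ (qFalling_pow_pos hq ht)]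
  refine (Finset.abs_sum_le_sum_abs _ _).trans ?_
  have hS : 0 ≤ ∑ w ∈ Finset.range (t + 1), q⁻¹ ^ (triangular w + m * (t - w)) :=
    Finset.sum_nonneg fun w _ => by positivity
  calc _ ≤ ∑ w ∈ Finset.range (t + 1),
        4 * q ^ (N * t) * q⁻¹ ^ (triangular w + m * (t - w)) := by
        refine Finset.sum_le_sum fun w hw => ?_
        have hw' : w ≤ t := Nat.lt_succ_iff.1 (Finset.mem_range.1 hw)
        rw [abs_mul, abs_mul, abs_of_pos (by positivity : 0 < q ^ (N * (t - w)))]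
        calc _ ≤ (4 * (q ^ (t * w) * q⁻¹ ^ triangular w)) *
              (q ^ (N * (t - w)) * q⁻¹ ^ (m * (t - w))) := by
              gcongr
              · exact abs_qWeight_le hq hw'
              · exact abs_qFalling_div_le hq hm ((Nat.sub_le t w).trans ht)
          _ = 4 * q ^ (t * w + N * (t - w)) * q⁻¹ ^ (triangular w + m * (t - w)) := by ring
          _ ≤ _ := by
              gcongr
              · linarith
              · calc t * w + N * (t - w) ≤ N * w + N * (t - w) := by gcongr
                  _ = N * t := by rw [← mul_add, Nat.add_sub_cancel' hw']
    _ = 16 * (∑ w ∈ Finset.range (t + 1), q⁻¹ ^ (triangular w + m * (t - w))) *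
          (q ^ (N * t) / 4) := by
        rw [← Finset.mul_sum]; ring
    _ ≤ _ := by
        gcongr
        exact qFalling_pow_ge hq ht

/-- `rankChar q N t m` is a polynomial of degree at most `t` in `q ^ (-m)`. -/
theorem exists_polynomial_rankChar (hq : 2 ≤ q) (N t : ℕ) :
    ∃ P : Polynomial ℝ, P.degree ≤ t ∧ ∀ m ≤ N, P.eval (q⁻¹ ^ m) = rankChar q N t m := by
  have hq0 : 0 < q := by linarith
  refine ⟨∑ w ∈ Finset.range (t + 1), Polynomial.C (qWeight q t w * (q ^ (N * (t - w)) *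
    (qFalling q (t - w) (q ^ N))⁻¹) / qFalling q t (q ^ N)) *
      ∏ i ∈ Finset.range (t - w), (Polynomial.C (q ^ N) * Polynomial.X - Polynomial.C (q ^ i)),
    ?_, fun m hm => ?_⟩
  · refine (Polynomial.degree_sum_le _ _).trans (Finset.sup_le fun w _ => ?_)
    refine (Polynomial.degree_mul_le _ _).trans ?_
    refine (add_le_add Polynomial.degree_C_le (Polynomial.degree_prod_le _ _)).trans ?_
    rw [zero_add]
    calc _ ≤ ∑ _i ∈ Finset.range (t - w), (1 : WithBot ℕ) := by
          refine Finset.sum_le_sum fun i _ => ?_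
          refine (Polynomial.degree_sub_le _ _).trans (max_le ?_ ?_)
          · exact Polynomial.degree_C_mul_X_le _
          · exact Polynomial.degree_C_le.trans (by norm_num)
      _ = ((t - w : ℕ) : WithBot ℕ) := by simp
      _ ≤ t := by exact_mod_cast Nat.sub_le t w
  · have h1 : q ^ (N - m) = q ^ N * q⁻¹ ^ m := by
      rw [inv_pow, ← div_eq_mul_inv, eq_div_iff (by positivity), ← pow_add, Nat.sub_add_cancel hm]
    rw [Polynomial.eval_finsetSum, rankChar, Finset.sum_div]
    refine Finset.sum_congr rfl fun w _ => ?_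
    rw [Polynomial.eval_mul, Polynomial.eval_C, Polynomial.eval_prod, h1]
    simp only [Polynomial.eval_sub, Polynomial.eval_mul, Polynomial.eval_C, Polynomial.eval_X]
    rw [← qFalling]
    ring

end Bounds

/-! ### The dual coefficients and their Fourier bound -/

section Dual

/-- The divided difference of order `#s - 1` annihilates polynomials of smaller degree. -/
theorem sum_eval_div_prod_eq_zero {s : Finset ℕ} {v : ℕ → ℝ} (hv : Set.InjOn v s)
    {P : Polynomial ℝ} (hP : P.degree < ((s.card - 1 : ℕ) : WithBot ℕ)) :
    ∑ i ∈ s, P.eval (v i) / ∏ j ∈ s.erase i, (v i - v j) = 0 := by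
  have h1 : P.degree < s.card := hP.trans_le (by exact_mod_cast Nat.sub_le _ _)
  rw [← Lagrange.coeff_eq_sum hv h1]
  exact Polynomial.coeff_eq_zero_of_degree_lt hP

variable {y : ℝ}

/-- A node `j < m` contributes at most `(1 - y ^ (m - j))⁻¹`, a node `j > m` at most `y ^ (j - m) *
(1 - y ^ (j - m))⁻¹`. Each of the two Euler products costs a factor `4`, and the powers of `y` add
up to a triangular number. -/
theorem prod_erase_dual_le (h0 : 0 < y) (h1 : y ≤ 1 / 2) {d r m : ℕ} (hdr : d < r) (hm : m ≤ d) :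
    ∏ j ∈ (Finset.range (d + 1)).erase m, |(y ^ r - y ^ j) / (y ^ m - y ^ j)| ≤
      16 * y ^ triangular (d - m) := by
  have hy1 : y < 1 := by linarith
  have e : ∏ j ∈ (Finset.range (d + 1)).erase m, |(y ^ r - y ^ j) / (y ^ m - y ^ j)| =
      ∏ j ∈ Finset.range (d + 1), if j = m then 1 else |(y ^ r - y ^ j) / (y ^ m - y ^ j)| := by
    rw [← Finset.prod_erase (Finset.range (d + 1)) (a := m) (by simp)]
    refine Finset.prod_congr rfl fun j hj => ?_
    rw [if_neg (Finset.ne_of_mem_erase hj)]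
  have hE : ∀ n, 0 < ∏ i ∈ Finset.range n, (1 - y ^ (i + 1)) := fun n =>
    lt_of_lt_of_le (by norm_num) (quarter_le_prod_one_sub_pow h0.le h1 n)
  have hpos : ∀ i : ℕ, 0 < 1 - y ^ (i + 1) := fun i =>
    sub_pos.2 (pow_lt_one₀ h0.le hy1 (Nat.succ_ne_zero i))
  have hlow : ∏ j ∈ Finset.range m, (if j = m then 1 else |(y ^ r - y ^ j) / (y ^ m - y ^ j)|) ≤
      4 := by
    calc _ ≤ ∏ j ∈ Finset.range m, (1 - y ^ (m - 1 - j + 1))⁻¹ := by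
          refine Finset.prod_le_prod (fun j _ => by split_ifs <;> positivity) fun j hj => ?_
          have hj' := Finset.mem_range.1 hj
          rw [if_neg (by omega), abs_div, abs_sub_comm, abs_sub_comm (y ^ m)]
          have h2 : y ^ r ≤ y ^ j := pow_le_pow_of_le_one h0.le hy1.le (by omega)
          have h3 : y ^ m = y ^ j * y ^ (m - 1 - j + 1) := by rw [← pow_add]; congr 1; omega
          have h4 := hpos (m - 1 - j)
          have h5 : y ^ j - y ^ m = y ^ j * (1 - y ^ (m - 1 - j + 1)) := by rw [h3]; ring
          have h6 : 0 < y ^ j := by positivity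
          rw [h5, abs_of_nonneg (sub_nonneg.2 h2), abs_of_pos (mul_pos h6 h4),
            div_le_iff₀ (mul_pos h6 h4), mul_comm (y ^ j), ← mul_assoc,
            inv_mul_cancel₀ h4.ne', one_mul]
          linarith [pow_pos h0 r]
      _ = (∏ j ∈ Finset.range m, (1 - y ^ (j + 1)))⁻¹ := by
          rw [Finset.prod_inv_distrib, Finset.prod_range_reflect (fun j => 1 - y ^ (j + 1))]
      _ ≤ (1 / 4)⁻¹ := inv_anti₀ (by norm_num) (quarter_le_prod_one_sub_pow h0.le h1 m)
      _ = 4 := by norm_num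
  have hhigh : ∏ i ∈ Finset.range (d - m), (if m + 1 + i = m then 1 else
      |(y ^ r - y ^ (m + 1 + i)) / (y ^ m - y ^ (m + 1 + i))|) ≤ 4 * y ^ triangular (d - m) := by
    calc _ ≤ ∏ i ∈ Finset.range (d - m), (y ^ (i + 1) * (1 - y ^ (i + 1))⁻¹) := by
          refine Finset.prod_le_prod (fun j _ => by split_ifs <;> positivity) fun i hi => ?_
          have hi' := Finset.mem_range.1 hi
          rw [if_neg (by omega), abs_div, abs_sub_comm]
          have h2 : y ^ r ≤ y ^ (m + 1 + i) := pow_le_pow_of_le_one h0.le hy1.le (by omega)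
          have h3 : y ^ (m + 1 + i) = y ^ m * y ^ (i + 1) := by rw [← pow_add]; congr 1; omega
          have h4 := hpos i
          have h5 : y ^ m - y ^ (m + 1 + i) = y ^ m * (1 - y ^ (i + 1)) := by rw [h3]; ring
          have h6 : 0 < y ^ m := by positivity
          rw [h5, abs_of_nonneg (sub_nonneg.2 h2), abs_of_pos (mul_pos h6 h4),
            div_le_iff₀ (mul_pos h6 h4)]
          have h7 : y ^ (i + 1) * (1 - y ^ (i + 1))⁻¹ * (y ^ m * (1 - y ^ (i + 1))) =
              y ^ (m + 1 + i) := by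
            rw [h3]; field_simp
          rw [h7]
          linarith [pow_pos h0 r]
      _ = y ^ triangular (d - m) * (∏ i ∈ Finset.range (d - m), (1 - y ^ (i + 1)))⁻¹ := by
          rw [Finset.prod_mul_distrib, Finset.prod_inv_distrib, prod_pow_succ_eq]
      _ ≤ y ^ triangular (d - m) * (1 / 4)⁻¹ := by
          gcongr
          exact quarter_le_prod_one_sub_pow h0.le h1 _
      _ = _ := by ring
  rw [e, show d + 1 = m + 1 + (d - m) by omega, Finset.prod_range_add, Finset.prod_range_succ,
    if_pos rfl, mul_one]
  calc _ ≤ 4 * (4 * y ^ triangular (d - m)) :=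
        mul_le_mul hlow hhigh (Finset.prod_nonneg fun i _ => by split_ifs <;> positivity)
          (by norm_num)
    _ = _ := by ring

/-- A dual object: coefficients supported on `{0, …, d} ∪ {r, N}` that are orthogonal to
polynomials of low degree in `y ^ m` and carry most of their mass on `r` and `N`. -/
theorem exists_dual_coeff (h0 : 0 < y) (h1 : y ≤ 1 / 2) {d r N : ℕ} (hdr : d < r) (hrN : r < N) :
    ∃ c : ℕ → ℝ, c r = -1 ∧ 0 ≤ c N ∧ c N ≤ 1 ∧
      (∀ m ≤ d, |c m| ≤ 16 * y ^ (r - m + triangular (d - m))) ∧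
      (∀ m, d < m → m ≠ r → m ≠ N → c m = 0) ∧
      ∀ P : Polynomial ℝ, P.degree ≤ ((d + 1 : ℕ) : WithBot ℕ) →
        ∑ m ∈ Finset.range (N + 1), c m * P.eval (y ^ m) = 0 := by
  have hy1 : y < 1 := by linarith
  have hanti : StrictAnti fun m : ℕ => y ^ m := pow_right_strictAnti₀ h0 hy1
  set v : ℕ → ℝ := fun m => y ^ m with hv
  have hne : ∀ i j, i ≠ j → v i - v j ≠ 0 := fun i j h =>
    sub_ne_zero.2 fun h' => h (hanti.injective h')
  set S : Finset ℕ := insert N (insert r (Finset.range (d + 1))) with hS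
  have hr : r ∉ Finset.range (d + 1) := by simp; omega
  have hN : N ∉ insert r (Finset.range (d + 1)) := by simp; omega
  have hcard : S.card = d + 3 := by
    rw [hS, Finset.card_insert_of_notMem hN, Finset.card_insert_of_notMem hr, Finset.card_range]
  set E : ℕ → ℝ := fun m => ∏ j ∈ S.erase m, (v m - v j) with hE
  have hE0 : ∀ m, E m ≠ 0 := fun m =>
    Finset.prod_ne_zero_iff.2 fun j hj => hne _ _ (Finset.ne_of_mem_erase hj).symm
  have hEN : E N = (v N - v r) * ∏ j ∈ Finset.range (d + 1), (v N - v j) := by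
    simp only [hE]
    rw [hS, Finset.erase_insert hN, Finset.prod_insert hr]
  have hEr : E r = (v r - v N) * ∏ j ∈ Finset.range (d + 1), (v r - v j) := by
    simp only [hE]
    rw [hS, Finset.erase_insert_of_ne (by omega : N ≠ r), Finset.erase_insert hr,
      Finset.prod_insert]
    simp; omega
  have hEm : ∀ m ≤ d, E m = (v m - v N) * ((v m - v r) *
      ∏ j ∈ (Finset.range (d + 1)).erase m, (v m - v j)) := by
    intro m hm
    simp only [hE]
    rw [hS, Finset.erase_insert_of_ne (by omega : N ≠ m),
      Finset.erase_insert_of_ne (by omega : r ≠ m), Finset.prod_insert, Finset.prod_insert]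
    · simp; omega
    · simp; omega
  have hcN : -(E r / E N) = ∏ j ∈ Finset.range (d + 1), ((v j - v r) / (v j - v N)) := by
    have h2 : ∀ j ∈ Finset.range (d + 1), (v j - v r) / (v j - v N) =
        (v r - v j) / (v N - v j) := fun j _ => by
      rw [← neg_div_neg_eq, neg_sub, neg_sub]
    rw [Finset.prod_congr rfl h2, Finset.prod_div_distrib, hEr, hEN, mul_div_mul_comm]
    rw [← neg_sub (v N) (v r), neg_div, div_self (hne N r (by omega))]
    ring
  have hfac : ∀ j ∈ Finset.range (d + 1), 0 ≤ (v j - v r) / (v j - v N) ∧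
      (v j - v r) / (v j - v N) ≤ 1 := by
    intro j hj
    have hj' := Finset.mem_range.1 hj
    have h2 : v r < v j := hanti (by omega)
    have h3 : v N < v r := hanti hrN
    exact ⟨div_nonneg (by linarith) (by linarith), (div_le_one (by linarith)).2 (by linarith)⟩
  -- These are the divided-difference weights `1 / E m`, scaled to give `-1` at `r`.
  refine ⟨fun m => if m ∈ S then -(E r / E m) else 0, ?_, ?_, ?_, ?_, ?_, ?_⟩
  · beta_reduce
    rw [if_pos (by simp [hS]), div_self (hE0 r)]
  · beta_reduce
    rw [if_pos (by simp [hS]), hcN]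
    exact Finset.prod_nonneg fun j hj => (hfac j hj).1
  · beta_reduce
    rw [if_pos (by simp [hS]), hcN]
    exact Finset.prod_le_one (fun j hj => (hfac j hj).1) fun j hj => (hfac j hj).2
  · intro m hm
    have hmem : m ∈ Finset.range (d + 1) := by simp; omega
    beta_reduce
    rw [if_pos (by simp [hS]; omega), abs_neg]
    have h2 : E r / E m = -((v r - v N) / (v m - v N)) *
        ∏ j ∈ (Finset.range (d + 1)).erase m, ((v r - v j) / (v m - v j)) := by
      rw [hEr, hEm m hm, ← Finset.mul_prod_erase _ _ hmem, Finset.prod_div_distrib]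
      have h3 := hne m r (by omega)
      have h4 := hne m N (by omega)
      have h5 : ∏ j ∈ (Finset.range (d + 1)).erase m, (v m - v j) ≠ 0 :=
        Finset.prod_ne_zero_iff.2 fun j hj => hne _ _ (Finset.ne_of_mem_erase hj).symm
      field_simp
      ring
    rw [h2, abs_mul, abs_neg, Finset.abs_prod]
    have h3 : v N < v r := hanti hrN
    have h4 : v r < v m := hanti (by omega)
    have h5 : |(v r - v N) / (v m - v N)| ≤ y ^ (r - m) := by
      rw [abs_of_nonneg (div_nonneg (by linarith) (by linarith)), div_le_iff₀ (by linarith)]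
      have h6 : v r = y ^ (r - m) * v m := by
        simp only [hv]
        rw [← pow_add, Nat.sub_add_cancel (by omega)]
      have h7 : y ^ (r - m) * v N ≤ v N :=
        mul_le_of_le_one_left (by positivity) (pow_le_one₀ h0.le hy1.le)
      rw [mul_sub, ← h6]
      linarith
    calc _ ≤ y ^ (r - m) * (16 * y ^ triangular (d - m)) :=
          mul_le_mul h5 (prod_erase_dual_le h0 h1 hdr hm)
            (Finset.prod_nonneg fun _ _ => abs_nonneg _) (by positivity)
      _ = _ := by ring
  · intro m h2 h3 h4
    beta_reduce
    rw [if_neg]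
    simp [hS]; omega
  · intro P hP
    have h2 : ∑ m ∈ S, P.eval (v m) / E m = 0 := by
      -- The `d + 3` nodes annihilate degrees up to `d + 1`.
      refine sum_eval_div_prod_eq_zero hanti.injective.injOn (hP.trans_lt ?_)
      rw [hcard]
      exact_mod_cast (by omega : d + 1 < d + 3 - 1)
    have hsub : S ⊆ Finset.range (N + 1) := by
      intro m hm
      simp only [hS, Finset.mem_insert, Finset.mem_range] at hm ⊢
      omega
    simp only [ite_mul, zero_mul]
    rw [← Finset.sum_filter, Finset.filter_mem_eq_inter, Finset.inter_eq_right.2 hsub]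
    calc _ = -E r * ∑ m ∈ S, P.eval (v m) / E m := by
          rw [Finset.mul_sum]
          exact Finset.sum_congr rfl fun m _ => by ring
      _ = 0 := by rw [h2, mul_zero]

/-! ### Exponent estimates -/

/-- As a function of `w`, `triangular w + m * (t - w)` is least at `w = m - 1` and `w = m`. The
bound is attained at `w = m`, `t = d + 2`, `k = 0`, by `triangular d = triangular m + triangular (d
- m) + m * (d - m)`. The extra `m` on the left makes the later sum over `m` geometric. -/
theorem exponent_low_ge {d r m t w k : ℕ} (hdr : d < r) (hm : m ≤ d) (ht : d + 2 ≤ t) (hw : w ≤ t)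
    (h : w = m + k ∨ m = w + 1 + k) :
    triangular d + r + m + k ≤
      r - m + triangular (d - m) + (triangular w + m * (t - w)) := by
  obtain ⟨a, rfl⟩ := Nat.exists_eq_add_of_le hm
  obtain ⟨b, rfl⟩ := Nat.exists_eq_add_of_lt hdr
  obtain ⟨s, rfl⟩ := Nat.exists_eq_add_of_le ht
  have e1 : m + a + b + 1 - m = a + b + 1 := by omega
  have e2 : m + a - m = a := by omega
  rw [e1, e2]
  have h1 := two_mul_triangular (m + a)
  have h2 := two_mul_triangular a
  have h3 := two_mul_triangular w
  rcases h with rfl | rfl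
  · obtain ⟨u, hu⟩ := Nat.exists_eq_add_of_le hw
    rw [hu, Nat.add_sub_cancel_left]
    have h4 : a + 2 + s = k + u := by omega
    have h5 : k * m + m * u = m * a + m * 2 + m * s := by rw [mul_comm k, ← mul_add, ← h4]; ring
    have h6 : k ≤ k * k := Nat.le_mul_self k
    nlinarith [Nat.zero_le (m * s)]
  · obtain ⟨u, hu⟩ := Nat.exists_eq_add_of_le hw
    rw [hu, Nat.add_sub_cancel_left]
    have h4 : u = k + 1 + a + 2 + s := by omega
    subst h4
    have h6 : k ≤ k * k := Nat.le_mul_self k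
    nlinarith [Nat.zero_le (w * s), Nat.zero_le (k * s)]

/-- At ranks `m ≥ r` the coefficients are only known to be at most `1`, so the character alone must
be small. Lowering `m` to `min r t` keeps the minimizing `w` within `w ≤ t`; `r ≤ 2 * d + 2` enters
when `r ≤ t`. -/
theorem exponent_high_ge {d r m m' t w k : ℕ} (hdr : d < r) (hrd : r ≤ 2 * d + 2) (hm : r ≤ m)
    (ht : d + 2 ≤ t) (hw : w ≤ t) (hm' : m' = min r t)
    (h : w = m' + k ∨ m' = w + 1 + k) :
    triangular d + r + k ≤ triangular w + m * (t - w) := by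
  have hm't : m' ≤ t := by omega
  have hm'm : m' ≤ m := by omega
  have h0 : triangular w + m' * (t - w) ≤ triangular w + m * (t - w) := by gcongr
  refine le_trans ?_ h0
  have h1 := two_mul_triangular d
  have h3 := two_mul_triangular w
  have hbase : d * (d + 1) + 2 * r ≤ m' * (2 * t - m' + 1) := by
    rcases le_total r t with hrt | hrt
    · have e : m' = r := by omega
      rw [e]
      calc d * (d + 1) + 2 * r ≤ r * (d + 1) + 2 * r := by gcongr
        _ = r * (d + 3) := by ring
        _ ≤ r * (2 * t - r + 1) := Nat.mul_le_mul_left _ (by omega)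
    · have e : m' = t := by omega
      rw [e, show 2 * t - t + 1 = t + 1 by omega]
      calc d * (d + 1) + 2 * r ≤ (d + 2) * (d + 2 + 1) := by nlinarith
        _ ≤ t * (t + 1) := by gcongr
  have h6 : k ≤ k * k := Nat.le_mul_self k
  obtain ⟨z, rfl⟩ := Nat.exists_eq_add_of_le hm't
  rw [show 2 * (m' + z) - m' + 1 = m' + 2 * z + 1 by omega] at hbase
  rcases h with rfl | rfl
  · obtain ⟨u, hu⟩ := Nat.exists_eq_add_of_le hw
    rw [hu, Nat.add_sub_cancel_left]
    have h4 : z = k + u := by omega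
    subst h4
    nlinarith
  · obtain ⟨u, hu⟩ := Nat.exists_eq_add_of_le hw
    rw [hu, Nat.add_sub_cancel_left]
    have h4 : u = k + 1 + z := by omega
    subst h4
    nlinarith

/-- For `t ≤ d + 1` the sum vanishes by orthogonality to polynomials. For `t ≥ d + 2` every term is
small: the ranks `r` and `N` contribute `64` each and the ranks up to `d` contribute `2 * 1024`. -/
theorem abs_sum_dual_mul_rankChar_le {q : ℝ} (hq : 2 ≤ q) {d r N t : ℕ} (hdr : d < r)
    (hrd : r ≤ 2 * d + 2) (hrN : r < N) (ht : t ≤ N) (c : ℕ → ℝ) (hcr : |c r| ≤ 1)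
    (hcN : |c N| ≤ 1) (hc : ∀ m ≤ d, |c m| ≤ 16 * q⁻¹ ^ (r - m + triangular (d - m)))
    (hc0 : ∀ m, d < m → m ≠ r → m ≠ N → c m = 0)
    (hP : ∀ P : Polynomial ℝ, P.degree ≤ ((d + 1 : ℕ) : WithBot ℕ) →
        ∑ m ∈ Finset.range (N + 1), c m * P.eval (q⁻¹ ^ m) = 0) :
    |∑ m ∈ Finset.range (N + 1), c m * rankChar q N t m| ≤
      2176 * q⁻¹ ^ (triangular d + r) := by
  have hq0 : 0 < q := by linarith
  have h0 : (0 : ℝ) ≤ q⁻¹ := by positivity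
  have h1 := inv_le_half hq
  rcases Nat.lt_or_ge t (d + 2) with htd | htd
  · obtain ⟨P, hdeg, hev⟩ := exists_polynomial_rankChar hq N t
    have h2 := hP P (hdeg.trans (by exact_mod_cast Nat.lt_succ_iff.1 htd))
    rw [Finset.sum_congr rfl fun m hm => by
      rw [← hev m (Nat.lt_succ_iff.1 (Finset.mem_range.1 hm))], h2, abs_zero]
    positivity
  · have hlow : ∀ m ∈ Finset.range (d + 1), |c m * rankChar q N t m| ≤
        1024 * q⁻¹ ^ (triangular d + r) * q⁻¹ ^ m := by
      intro m hm
      have hm' : m ≤ d := Nat.lt_succ_iff.1 (Finset.mem_range.1 hm)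
      rw [abs_mul]
      calc _ ≤ (16 * q⁻¹ ^ (r - m + triangular (d - m))) *
            (16 * ∑ w ∈ Finset.range (t + 1), q⁻¹ ^ (triangular w + m * (t - w))) :=
            mul_le_mul (hc m hm') (abs_rankChar_le hq ht (by omega)) (abs_nonneg _)
              (by positivity)
        _ = 256 * ∑ w ∈ Finset.range (t + 1),
            q⁻¹ ^ (r - m + triangular (d - m) + (triangular w + m * (t - w))) := by
            simp only [pow_add _ (r - m + triangular (d - m)), ← Finset.mul_sum]
            ring
        _ ≤ 256 * (4 * q⁻¹ ^ (triangular d + r + m)) := by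
            gcongr
            exact sum_range_pow_le h0 h1 _ m _ _
              (fun k hk => exponent_low_ge hdr hm' htd (by omega) (Or.inl rfl))
              (fun w k hw hk => exponent_low_ge hdr hm' htd (by omega) (Or.inr hk))
        _ = _ := by ring
    have hhigh : ∀ m, r ≤ m → m ≤ N → |c m| ≤ 1 → |c m * rankChar q N t m| ≤
        64 * q⁻¹ ^ (triangular d + r) := by
      intro m hm hmN hcm
      rw [abs_mul]
      calc _ ≤ 1 * (16 * ∑ w ∈ Finset.range (t + 1), q⁻¹ ^ (triangular w + m * (t - w))) :=
            mul_le_mul hcm (abs_rankChar_le hq ht hmN) (abs_nonneg _) zero_le_one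
        _ ≤ 1 * (16 * (4 * q⁻¹ ^ (triangular d + r))) := by
            gcongr
            exact sum_range_pow_le h0 h1 _ (min r t) _ _
              (fun k hk => exponent_high_ge hdr hrd hm htd (by omega) rfl (Or.inl rfl))
              (fun w k hw hk => exponent_high_ge hdr hrd hm htd (by omega) rfl (Or.inr hk))
        _ = _ := by ring
    have hr : r ∉ Finset.range (d + 1) := by simp; omega
    have hN : N ∉ insert r (Finset.range (d + 1)) := by simp; omega
    have hsub : insert N (insert r (Finset.range (d + 1))) ⊆ Finset.range (N + 1) := by
      intro m hm
      simp only [Finset.mem_insert, Finset.mem_range] at hm ⊢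
      omega
    rw [← Finset.sum_subset hsub (fun m _ hm => by
      simp only [Finset.mem_insert, Finset.mem_range, not_or] at hm
      rw [hc0 m (by omega) hm.2.1 hm.1, zero_mul])]
    refine (Finset.abs_sum_le_sum_abs _ _).trans ?_
    rw [Finset.sum_insert hN, Finset.sum_insert hr]
    calc _ ≤ 64 * q⁻¹ ^ (triangular d + r) + (64 * q⁻¹ ^ (triangular d + r) +
          ∑ m ∈ Finset.range (d + 1), 1024 * q⁻¹ ^ (triangular d + r) * q⁻¹ ^ m) :=
          add_le_add (hhigh N hrN.le le_rfl hcN) (add_le_add (hhigh r le_rfl hrN.le hcr)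
            (Finset.sum_le_sum hlow))
      _ ≤ 64 * q⁻¹ ^ (triangular d + r) + (64 * q⁻¹ ^ (triangular d + r) +
          1024 * q⁻¹ ^ (triangular d + r) * 2) := by
          rw [← Finset.mul_sum]
          gcongr
          exact sum_range_pow_le_two h0 h1 _
      _ = _ := by ring

theorem sum_abs_dual_le (h0 : 0 < y) (h1 : y ≤ 1 / 2) {d r : ℕ} (hdr : d < r) (c : ℕ → ℝ)
    (hc : ∀ m ≤ d, |c m| ≤ 16 * y ^ (r - m + triangular (d - m))) :
    ∑ m ∈ Finset.range (d + 1), |c m| ≤ 32 * y ^ (r - d) := by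
  calc _ ≤ ∑ m ∈ Finset.range (d + 1), 16 * y ^ (r - d) * y ^ (d + 1 - 1 - m) := by
        refine Finset.sum_le_sum fun m hm => ?_
        have hm' : m ≤ d := Nat.lt_succ_iff.1 (Finset.mem_range.1 hm)
        refine (hc m hm').trans ?_
        rw [mul_assoc, ← pow_add]
        gcongr 16 * ?_
        exact pow_le_pow_of_le_one h0.le (by linarith) (by omega)
    _ = 16 * y ^ (r - d) * ∑ m ∈ Finset.range (d + 1), y ^ m := by
        rw [← Finset.mul_sum, Finset.sum_range_reflect (fun m => y ^ m)]
    _ ≤ 16 * y ^ (r - d) * 2 := by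
        gcongr
        exact sum_range_pow_le_two h0.le h1 _
    _ = _ := by ring

end Dual

/-! ### The advantage bound from rectangles -/

section Communication

variable {F : Type*} [Field F] [Fintype F] {N : ℕ}

/-- If `h` distinguishes `rk (A + B) = r` from `rk (A + B) = N` with advantage `η`, and `h`
correlates with every `Φ` at most `T` times as well as combinatorial rectangles do, then `T` is
large. -/
theorem advantage_le_of_rectangles {r : ℕ} (hr : 1 ≤ r) (hrN : r < N)
    (h : Matrix (Fin N) (Fin N) F → Matrix (Fin N) (Fin N) F → ℝ) (hh : ∀ A B, |h A B| ≤ 1)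
    (η : ℝ) (hη : 0 ≤ η) (hlow : ∀ A B, (A + B).rank = r → h A B ≤ -η)
    (hhigh : ∀ A B, (A + B).rank = N → η ≤ h A B) (T : ℝ)
    (hT : ∀ (Φ : Matrix (Fin N) (Fin N) F → Matrix (Fin N) (Fin N) F → ℝ) (D : ℝ),
      (∀ f g : Matrix (Fin N) (Fin N) F → ℝ, (∀ x, |f x| ≤ 1) → (∀ y, |g y| ≤ 1) →
        |∑ x, ∑ y, f x * g y * Φ x y| ≤ D) → |∑ x, ∑ y, Φ x y * h x y| ≤ T * D) :
    η ≤ 32 * (Fintype.card F : ℝ)⁻¹ ^ (r - (r - 1) / 2) +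
      T * (2176 * (Fintype.card F : ℝ)⁻¹ ^ (triangular ((r - 1) / 2) + r)) := by
  classical
  set q : ℝ := (Fintype.card F : ℝ) with hq
  have hq2 : 2 ≤ q := by
    rw [hq]; exact_mod_cast Fintype.one_lt_card (α := F)
  have hq0 : 0 < q := by linarith
  have h0 : 0 < q⁻¹ := by positivity
  have h1 := inv_le_half hq2
  -- This balances the two errors: `r - d > r / 2` keeps the spill far below `q ^ (-r/3)`, while
  -- `triangular d` is still about `r ^ 2 / 8`.
  set d := (r - 1) / 2 with hd
  have hdr : d < r := by omega
  have hrd : r ≤ 2 * d + 2 := by omega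
  obtain ⟨c, hcr, hcN0, hcN1, hc, hc0, hP⟩ := exists_dual_coeff h0 h1 hdr hrN
  obtain ⟨ψ, hψ1⟩ := AddChar.exists_apply_ne_zero.2 (one_ne_zero : (1 : F) ≠ 0)
  have hψ : ψ ≠ 1 := by
    rintro rfl
    exact hψ1 (AddChar.one_apply _)
  have hnum : ∀ m ≤ N, 0 < numRank F N m := fun m hm =>
    (sum_rank_eq_char ψ hψ hm (0 : Matrix (Fin N) (Fin N) F)).2
  set V : ℝ := (Fintype.card (Matrix (Fin N) (Fin N) F) : ℝ) with hV
  have hV0 : 0 < V := by rw [hV]; exact_mod_cast Fintype.card_pos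
  set φ : Matrix (Fin N) (Fin N) F → ℝ := fun A => c A.rank / numRank F N A.rank with hφ
  have hup : |∑ A, ∑ B, φ (A + B) * h A B| ≤ T * (V * (2176 * q⁻¹ ^ (triangular d + r))) := by
    refine hT (fun A B => φ (A + B)) _ fun f g hf hg => ?_
    refine abs_sum_mul_add_le (fun A B : Matrix (Fin N) (Fin N) F => ψ (A * B).trace)
      (fun A A' B => ?_) (fun A B => ?_) (fun A hA => sum_char_trace_mul_eq_zero ψ hψ A hA)
      (fun B => ?_) φ _ (fun B => ?_) f g hf hg
    · rw [Matrix.add_mul, Matrix.trace_add, AddChar.map_add_eq_mul]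
    · rw [Matrix.neg_mul, Matrix.trace_neg, AddChar.map_neg_eq_conj]
    · rw [Matrix.zero_mul, Matrix.trace_zero, AddChar.map_zero_eq_one]
    · rw [hφ, sum_rank_function_mul_char ψ hψ c B, Complex.norm_real, Real.norm_eq_abs]
      exact abs_sum_dual_mul_rankChar_le hq2 hdr hrd hrN B.rank_le_fin c (by rw [hcr]; norm_num)
        (abs_le.2 ⟨by linarith, hcN1⟩) hc hc0 hP
  set H : Matrix (Fin N) (Fin N) F → ℝ := fun C => ∑ A, h A (C - A) with hH
  have hsum : ∑ A, ∑ B, φ (A + B) * h A B = ∑ C, φ C * H C := by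
    have e : ∀ A, ∑ B, φ (A + B) * h A B = ∑ C, φ C * h A (C - A) := fun A => by
      rw [← Equiv.sum_comp (Equiv.addLeft A) (fun C => φ C * h A (C - A))]
      exact Finset.sum_congr rfl fun B _ => by simp
    simp_rw [e, hH, Finset.mul_sum]
    exact Finset.sum_comm
  have hHabs : ∀ C, |H C| ≤ V := fun C => by
    refine (Finset.abs_sum_le_sum_abs _ _).trans ?_
    calc _ ≤ ∑ _A : Matrix (Fin N) (Fin N) F, (1 : ℝ) := Finset.sum_le_sum fun A _ => hh _ _
      _ = V := by simp [hV]
  have hHlow : ∀ C, C.rank = r → H C ≤ -η * V := fun C hC => by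
    calc _ ≤ ∑ _A : Matrix (Fin N) (Fin N) F, -η :=
          Finset.sum_le_sum fun A _ => hlow _ _ (by rwa [add_sub_cancel])
      _ = -η * V := by simp [hV, mul_comm]
  have hHhigh : ∀ C, C.rank = N → η * V ≤ H C := fun C hC => by
    calc η * V = ∑ _A : Matrix (Fin N) (Fin N) F, η := by simp [hV, mul_comm]
      _ ≤ _ := Finset.sum_le_sum fun A _ => hhigh _ _ (by rwa [add_sub_cancel])
  -- The average of `H` over the matrices of rank `m`, so that the correlation with `φ` becomes `∑ c
  -- m * K m`.
  set K : ℕ → ℝ := fun m => (∑ C, if C.rank = m then H C else 0) / numRank F N m with hK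
  have hbound : ∀ m ≤ N, ∀ x : ℝ, (∀ C : Matrix (Fin N) (Fin N) F, C.rank = m → H C ≤ x) →
      K m ≤ x := by
    intro m hm x hx
    rw [hK, div_le_iff₀ (hnum m hm), numRank, Finset.card_filter, Nat.cast_sum, Finset.mul_sum]
    refine Finset.sum_le_sum fun C _ => ?_
    split_ifs with hC
    · simpa using hx C hC
    · simp
  have hbound' : ∀ m ≤ N, ∀ x : ℝ, (∀ C : Matrix (Fin N) (Fin N) F, C.rank = m → x ≤ H C) →
      x ≤ K m := by
    intro m hm x hx
    rw [hK, le_div_iff₀ (hnum m hm), numRank, Finset.card_filter, Nat.cast_sum, Finset.mul_sum]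
    refine Finset.sum_le_sum fun C _ => ?_
    split_ifs with hC
    · simpa using hx C hC
    · simp
  have hKabs : ∀ m ≤ N, |K m| ≤ V := fun m hm =>
    abs_le.2 ⟨hbound' m hm _ fun C _ => (abs_le.1 (hHabs C)).1,
      hbound m hm _ fun C _ => (abs_le.1 (hHabs C)).2⟩
  have hKr := hbound r hrN.le _ hHlow
  have hKN := hbound' N le_rfl _ hHhigh
  have hsum2 : ∑ C, φ C * H C = ∑ m ∈ Finset.range (N + 1), c m * K m := by
    rw [sum_rank_fiber]
    refine Finset.sum_congr rfl fun m _ => ?_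
    rw [hK, mul_div_assoc', Finset.mul_sum, Finset.sum_div]
    refine Finset.sum_congr rfl fun C _ => ?_
    split_ifs with hC
    · rw [hφ]; simp only [hC]; ring
    · simp
  have hrmem : r ∉ Finset.range (d + 1) := by simp; omega
  have hNmem : N ∉ insert r (Finset.range (d + 1)) := by simp; omega
  have hsub : insert N (insert r (Finset.range (d + 1))) ⊆ Finset.range (N + 1) := by
    intro m hm
    simp only [Finset.mem_insert, Finset.mem_range] at hm ⊢
    omega
  rw [← Finset.sum_subset hsub (fun m _ hm => by
    simp only [Finset.mem_insert, Finset.mem_range, not_or] at hm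
    rw [hc0 m (by omega) hm.2.1 hm.1, zero_mul]), Finset.sum_insert hNmem,
    Finset.sum_insert hrmem, hcr] at hsum2
  have hspill : -(32 * q⁻¹ ^ (r - d) * V) ≤ ∑ m ∈ Finset.range (d + 1), c m * K m := by
    refine (abs_le.1 (?_ : |∑ m ∈ Finset.range (d + 1), c m * K m| ≤ _)).1
    calc _ ≤ ∑ m ∈ Finset.range (d + 1), |c m| * V := by
          refine (Finset.abs_sum_le_sum_abs _ _).trans (Finset.sum_le_sum fun m hm => ?_)
          have := Finset.mem_range.1 hm
          rw [abs_mul]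
          gcongr
          exact hKabs m (by omega)
      _ = (∑ m ∈ Finset.range (d + 1), |c m|) * V := by rw [Finset.sum_mul]
      _ ≤ _ := by
          gcongr
          exact sum_abs_dual_le h0 h1 hdr c hc
  -- Rank `N` only has to contribute with the right sign; the gain `η * V` comes from `c r = -1`.
  have hN0 : 0 ≤ c N * K N := mul_nonneg hcN0 (le_trans (by positivity) hKN)
  have hfin := (le_abs_self _).trans hup
  rw [hsum, hsum2] at hfin
  refine le_of_mul_le_mul_right (?_ : _ * V ≤ _ * V) hV0
  linarith

end Communication

/-! ### From the advantage to the space bound -/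

section Numeric

/-- The numerical core: a small advantage with `2 ^ (2 b)` rectangles forces `b` to be large. -/
theorem mul_sq_logb_le_of_advantage {q : ℝ} (hq : 2 ≤ q) {r b : ℕ} (hr : 1 ≤ r) (hb : 1 ≤ b)
    (h : 1 / 2 * q ^ (-(r : ℝ) / 3) ≤ 32 * q⁻¹ ^ (r - (r - 1) / 2) +
      2 ^ (2 * b) * (2176 * q⁻¹ ^ (triangular ((r - 1) / 2) + r))) :
    1 / 1764 * ((r : ℝ) ^ 2 * Real.logb 2 q) ≤ b := by
  have hq0 : 0 < q := by linarith
  set L := Real.logb 2 q with hL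
  have hL1 : 1 ≤ L := by
    rw [hL, Real.le_logb_iff_rpow_le (by norm_num) hq0]; simpa using hq
  have hqL : q = (2 : ℝ) ^ L := (Real.rpow_logb (by norm_num) (by norm_num) hq0).symm
  have hr1 : (1 : ℝ) ≤ r := by exact_mod_cast hr
  have hb1 : (1 : ℝ) ≤ b := by exact_mod_cast hb
  -- Below `42` the claim follows from `b ≥ 1`, as `r ^ 2 * L ≤ 42 ^ 2 = 1764`. From `42` on, `r * L
  -- / 6 ≥ 7` absorbs `32 = 2 ^ 7 / 4`, so the spill is at most half of the advantage.
  rcases lt_or_ge ((r : ℝ) * L) 42 with hs | hs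
  · have : (r : ℝ) ^ 2 * L ≤ 1764 := by
      have hr42 : (r : ℝ) ≤ 42 := by nlinarith
      calc (r : ℝ) ^ 2 * L = r * (r * L) := by ring
        _ ≤ 42 * 42 := by gcongr
        _ = 1764 := by norm_num
    linarith
  · set d := (r - 1) / 2 with hd
    have hdr : d ≤ r := by omega
    have hd1 : 2 * (d : ℝ) + 1 ≤ r := by
      have : 2 * d + 1 ≤ r := by omega
      exact_mod_cast this
    have hd2 : (r : ℝ) ≤ 2 * d + 2 := by
      have : r ≤ 2 * d + 2 := by omega
      exact_mod_cast this
    have hpow : ∀ k : ℕ, q⁻¹ ^ k = (2 : ℝ) ^ (-(L * k)) := by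
      intro k
      rw [Real.rpow_neg (by norm_num), Real.rpow_mul (by norm_num), ← hqL, Real.rpow_natCast,
        inv_pow]
    have hη : q ^ (-(r : ℝ) / 3) = (2 : ℝ) ^ (-(L * r / 3)) := by
      rw [hqL, ← Real.rpow_mul (by norm_num)]
      congr 1
      ring
    have htri : (triangular d : ℝ) = d * (d + 1) / 2 := by
      have := two_mul_triangular d
      have h' : 2 * (triangular d : ℝ) = d * (d + 1) := by exact_mod_cast this
      linarith
    rw [hη, hpow, hpow, Nat.cast_sub hdr, Nat.cast_add, htri] at h
    have hspill : 32 * (2 : ℝ) ^ (-(L * (r - d))) ≤ 1 / 4 * 2 ^ (-(L * r / 3)) := by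
      have e : (1 / 4 : ℝ) * 2 ^ (-(L * r / 3)) = 32 * 2 ^ (-(L * r / 3) - 7) := by
        rw [Real.rpow_sub (by norm_num)]
        norm_num
        ring
      rw [e]
      gcongr
      · norm_num
      · nlinarith
    have hmain : 1 / 4 * (2 : ℝ) ^ (-(L * r / 3)) ≤
        2 ^ (2 * b) * (2176 * 2 ^ (-(L * (d * (d + 1) / 2 + r)))) := by linarith
    have hmain2 : (2 : ℝ) ^ (-(L * r / 3) - 2) ≤
        2 ^ (2 * (b : ℝ) + 12 - L * (d * (d + 1) / 2 + r)) := by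
      calc (2 : ℝ) ^ (-(L * r / 3) - 2) = 1 / 4 * (2 : ℝ) ^ (-(L * r / 3)) := by
            rw [Real.rpow_sub (by norm_num)]
            norm_num
            ring
        _ ≤ 2 ^ (2 * b) * (2176 * 2 ^ (-(L * (d * (d + 1) / 2 + r)))) := hmain
        _ ≤ 2 ^ (2 * b) * (2 ^ (12 : ℕ) * 2 ^ (-(L * (d * (d + 1) / 2 + r)))) := by
            gcongr
            norm_num
        _ = _ := by
            rw [← Real.rpow_natCast 2 (2 * b), ← Real.rpow_natCast 2 12, ← mul_assoc,
              ← Real.rpow_add (by norm_num), ← Real.rpow_add (by norm_num)]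
            congr 1
            push_cast
            ring
    have hexp := (Real.rpow_le_rpow_left_iff (by norm_num : (1 : ℝ) < 2)).1 hmain2
    have hdd : (r : ℝ) ^ 2 / 8 - r / 4 ≤ d * (d + 1) / 2 := by nlinarith
    have h3 : L * ((r : ℝ) ^ 2 / 8 - r / 4) ≤ L * (d * (d + 1) / 2) := by gcongr
    nlinarith [mul_nonneg (sq_nonneg (r : ℝ)) (by linarith : (0 : ℝ) ≤ L)]

end Numeric

/-! ### Embedding the rank of a sum into a split matrix -/

section BlockMatrix

variable {F : Type*} [Field F]

/-- Reducing `C` to diagonal form by transvections makes the whole block matrix diagonal, and then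
ranks count nonzero entries. -/
theorem Matrix.rank_fromBlocks_diagonal {m κ : Type*} [Fintype m] [DecidableEq m] [Fintype κ]
    [DecidableEq κ] (C : Matrix m m F) (z : κ → F) :
    (Matrix.fromBlocks C 0 0 (Matrix.diagonal z)).rank = C.rank + (Matrix.diagonal z).rank := by
  classical
  obtain ⟨L, L', D, hC⟩ := Matrix.Pivot.exists_list_transvec_mul_diagonal_mul_list_transvec C
  set P := (L.map Matrix.TransvectionStruct.toMatrix).prod
  set P' := (L'.map Matrix.TransvectionStruct.toMatrix).prod
  have hP : P.det = 1 := Matrix.TransvectionStruct.det_toMatrix_prod L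
  have hP' : P'.det = 1 := Matrix.TransvectionStruct.det_toMatrix_prod L'
  have h1 : Matrix.fromBlocks C 0 0 (Matrix.diagonal z) =
      Matrix.fromBlocks P 0 0 1 * Matrix.diagonal (Sum.elim D z) *
        Matrix.fromBlocks P' 0 0 1 := by
    rw [← Matrix.fromBlocks_diagonal, Matrix.fromBlocks_multiply, Matrix.fromBlocks_multiply, hC]
    simp
  have h2 : C.rank = (Matrix.diagonal D).rank := by
    rw [hC, Matrix.rank_mul_eq_left_of_isUnit_det _ _ (by rw [hP']; exact isUnit_one),
      Matrix.rank_mul_eq_right_of_isUnit_det _ _ (by rw [hP]; exact isUnit_one)]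
  rw [h1, h2, Matrix.rank_mul_eq_left_of_isUnit_det, Matrix.rank_mul_eq_right_of_isUnit_det,
    Matrix.rank_diagonal, Matrix.rank_diagonal, Matrix.rank_diagonal,
    Fintype.card_congr (Equiv.subtypeSum), Fintype.card_sum]
  · rfl
  · rw [Matrix.det_fromBlocks_zero₂₁, hP, Matrix.det_one, mul_one]; exact isUnit_one
  · rw [Matrix.det_fromBlocks_zero₂₁, hP', Matrix.det_one, mul_one]; exact isUnit_one

/-- Two players holding the upper and the lower rows can embed the rank of `A + B` into the rank of
a matrix, shifted by `h`. -/
theorem exists_split_matrix {n N h : ℕ} (hN : N ≤ h) (hn : h + N ≤ n) :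
    ∃ P Q : Matrix (Fin N) (Fin N) F → Matrix (Fin n) (Fin n) F, ∀ A B,
      (Matrix.of fun (i : Fin n) j => if (i : ℕ) < N then P A i j else Q B i j).rank =
        h + (A + B).rank := by
  classical
  let X : Matrix (Fin N) (Fin (n - N)) F := Matrix.of fun i k => if (i : ℕ) = k then 1 else 0
  let z : Fin (n - N) → F := fun k => if (k : ℕ) < h then 1 else 0
  let Z : Matrix (Fin (n - N)) (Fin (n - N)) F := Matrix.diagonal z
  have hXX : X * X.transpose = 1 := by
    ext i j
    rw [Matrix.mul_apply, Finset.sum_eq_single (⟨i, by omega⟩ : Fin (n - N))]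
    · simp [X, Matrix.one_apply, Fin.ext_iff, eq_comm]
    · intro b _ hb
      have : (i : ℕ) ≠ b := fun h' => hb (Fin.ext h'.symm)
      simp [X, this]
    · simp
  have hXZ : X * Z = X := by
    ext i k
    simp only [Z, Matrix.mul_diagonal, X, z, Matrix.of_apply]
    by_cases hik : (i : ℕ) = k
    · rw [if_pos hik, if_pos (by omega), mul_one]
    · rw [if_neg hik, zero_mul]
  have hZX : Z * X.transpose = X.transpose := by
    have := congrArg Matrix.transpose hXZ
    rwa [Matrix.transpose_mul, Matrix.diagonal_transpose] at this
  have hZ : Z.rank = h := by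
    rw [Matrix.rank_diagonal, Fintype.card_subtype]
    have : (Finset.univ.filter fun k : Fin (n - N) => z k ≠ 0) =
        Finset.univ.filter fun k : Fin (n - N) => (k : ℕ) < h := by
      ext k; simp [z]
    rw [this, Fin.card_filter_val_lt]
    omega
  let e : Fin N ⊕ Fin (n - N) ≃ Fin n := finSumFinEquiv.trans (finCongr (by omega))
  refine ⟨fun A => (Matrix.fromBlocks A X 0 Z).submatrix e.symm e.symm,
    fun B => (Matrix.fromBlocks 0 X (-(X.transpose * B)) Z).submatrix e.symm e.symm,
    fun A B => ?_⟩
  have h1 : (Matrix.of fun i j : Fin n => if (i : ℕ) < N then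
      (Matrix.fromBlocks A X 0 Z).submatrix e.symm e.symm i j else
      (Matrix.fromBlocks 0 X (-(X.transpose * B)) Z).submatrix e.symm e.symm i j) =
      (Matrix.fromBlocks A X (-(X.transpose * B)) Z).submatrix e.symm e.symm := by
    ext i j
    obtain ⟨i, rfl⟩ := e.surjective i
    rw [Matrix.of_apply]
    simp only [Matrix.submatrix_apply, Equiv.symm_apply_apply]
    rcases i with i | i
    · rw [if_pos (by simp [e])]
      rcases e.symm j with j | j <;> rfl
    · rw [if_neg (by simp [e])]
      rcases e.symm j with j | j <;> rfl
  -- Block elimination: `X * Z = X` clears the upper right block, `X * Xᵀ = 1` turns the upper left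
  -- one into `A + B`, and `Z * Xᵀ = Xᵀ` clears the lower left one.
  have h2 : Matrix.fromBlocks 1 (-X) 0 1 * Matrix.fromBlocks A X (-(X.transpose * B)) Z *
      Matrix.fromBlocks 1 0 (X.transpose * B) 1 = Matrix.fromBlocks (A + B) 0 0 Z := by
    rw [Matrix.fromBlocks_multiply, Matrix.fromBlocks_multiply]
    simp only [Matrix.one_mul, Matrix.mul_one, Matrix.zero_mul, Matrix.mul_zero, zero_add,
      Matrix.neg_mul, Matrix.mul_neg, neg_neg, add_zero, hXZ, add_neg_cancel]
    rw [← Matrix.mul_assoc X, hXX, ← Matrix.mul_assoc Z, hZX, Matrix.one_mul, neg_add_cancel]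
  have h3 : (Matrix.fromBlocks A X (-(X.transpose * B)) Z).rank = (A + B).rank + Z.rank := by
    rw [← Matrix.rank_fromBlocks_diagonal, ← h2, Matrix.rank_mul_eq_left_of_isUnit_det,
      Matrix.rank_mul_eq_right_of_isUnit_det]
    · rw [Matrix.det_fromBlocks_zero₂₁]; simp
    · rw [Matrix.det_fromBlocks_zero₁₂]; simp
  rw [h1, Matrix.rank_submatrix, h3, hZ, add_comm]

end BlockMatrix

theorem exists_rank_eq (F : Type*) [Field F] {N t : ℕ} (ht : t ≤ N) :
    ∃ C : Matrix (Fin N) (Fin N) F, C.rank = t := by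
  classical
  refine ⟨Matrix.diagonal fun k => if (k : ℕ) < t then 1 else 0, ?_⟩
  rw [Matrix.rank_diagonal, Fintype.card_subtype]
  simp only [ne_eq, ite_eq_right_iff, one_ne_zero, imp_false, not_not]
  rw [Fin.card_filter_val_lt]
  omega

/-! ### The streaming lower bound -/

namespace RandStreamAlg

theorem outputProb_nonneg {F : Type*} {n k s : ℕ} {β : Type*} [MeasurableSpace β]
    (A : RandStreamAlg F n k s β) (M : Matrix (Fin n) (Fin n) F) (E : Set β) :
    0 ≤ A.outputProb M E :=
  measureReal_nonneg

theorem outputProb_le_one {F : Type*} {n k s : ℕ} {β : Type*} [MeasurableSpace β]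
    (A : RandStreamAlg F n k s β) (M : Matrix (Fin n) (Fin n) F) (E : Set β) :
    A.outputProb M E ≤ 1 :=
  have := A.isProb
  measureReal_le_one

theorem outputProb_mono {F : Type*} {n k s : ℕ} {β : Type*} [MeasurableSpace β]
    (A : RandStreamAlg F n k s β) (M : Matrix (Fin n) (Fin n) F) {E E' : Set β} (h : E ⊆ E') :
    A.outputProb M E ≤ A.outputProb M E' :=
  have := A.isProb
  measureReal_mono fun _ hω => h hω

/-- Postprocessing of the output. -/
def map {F : Type u} {n k s : ℕ} {β : Type v} [MeasurableSpace β] {γ : Type v}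
    [MeasurableSpace γ] (A : RandStreamAlg.{u, v, w} F n k s β) (g : β → γ) (hg : Measurable g) :
    RandStreamAlg.{u, v, w} F n k s γ :=
  { Ω := A.Ω
    mΩ := A.mΩ
    μ := A.μ
    isProb := A.isProb
    alg := fun ω => ⟨(A.alg ω).init, (A.alg ω).step, fun σ => g ((A.alg ω).output σ)⟩
    measurable_run := fun M => hg.comp (A.measurable_run M) }

theorem outputProb_map {F : Type u} {n k s : ℕ} {β : Type v} [MeasurableSpace β] {γ : Type v}
    [MeasurableSpace γ] (A : RandStreamAlg.{u, v, w} F n k s β) (g : β → γ) (hg : Measurable g)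
    (M : Matrix (Fin n) (Fin n) F) (E : Set γ) :
    (A.map g hg).outputProb M E = A.outputProb M (g ⁻¹' E) :=
  rfl

theorem ComputesWithError.mono {F : Type*} {n k s : ℕ} {A : RandStreamAlg F n k s ℤˣ}
    {f : Matrix (Fin n) (Fin n) F → Option ℤˣ} {ε ε' : ℝ} (h : A.ComputesWithError f ε)
    (hε : ε ≤ ε') : A.ComputesWithError f ε' :=
  fun M b hM => le_trans (by linarith) (h M b hM)

/-- A streaming algorithm that distinguishes rank `r` from rank `R` with a small advantage needs
much space or many passes. -/
theorem mul_sq_logb_le_of_computesWithError {F : Type u} [Field F] [Fintype F] {n r R k s : ℕ}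
    (A : RandStreamAlg.{u, 0, w} F n k s ℤˣ) (hnr : (n : ℝ) / 2 ≤ r) (hrR : r < R) (hRn : R ≤ n)
    (hA : A.ComputesWithError (rankProblem n r R)
      (1 / 2 - 1 / 4 * (Fintype.card F : ℝ) ^ (-((r : ℝ) - (⌈(n : ℝ) / 2⌉₊ : ℝ)) / 3))) :
    1 / 1764 * (((r : ℝ) - (⌈(n : ℝ) / 2⌉₊ : ℝ)) ^ 2 * Real.logb 2 (Fintype.card F))
      ≤ (s : ℝ) * (k : ℝ) := by
  set q : ℝ := (Fintype.card F : ℝ) with hq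
  have hq2 : 2 ≤ q := by rw [hq]; exact_mod_cast Fintype.one_lt_card (α := F)
  set h := ⌈(n : ℝ) / 2⌉₊ with hh
  have hhr : h ≤ r := Nat.ceil_le.2 hnr
  have hnh : n ≤ 2 * h := by
    have := Nat.le_ceil ((n : ℝ) / 2)
    rw [← hh] at this
    have h' : (n : ℝ) ≤ 2 * h := by linarith
    exact_mod_cast h'
  obtain ⟨ρ, rfl⟩ := Nat.exists_eq_add_of_le hhr
  have hρ : ((h + ρ : ℕ) : ℝ) - h = ρ := by push_cast; ring
  rw [hρ] at hA ⊢
  rcases Nat.eq_zero_or_pos ρ with rfl | hρ1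
  · simp only [Nat.cast_zero, ne_eq, OfNat.ofNat_ne_zero, not_false_eq_true, zero_pow, zero_mul,
      mul_zero]
    positivity
  -- Here `N = R - h ≤ h`, because `R ≤ n ≤ 2 * h`; the embedding needs this.
  obtain ⟨N, rfl⟩ := Nat.exists_eq_add_of_le (show h ≤ R by omega)
  obtain ⟨P, Q, hPQ⟩ := exists_split_matrix (F := F) (n := n) (N := N) (h := h) (by omega) hRn
  set M : Matrix (Fin N) (Fin N) F → Matrix (Fin N) (Fin N) F → Matrix (Fin n) (Fin n) F :=
    fun X Y => Matrix.of fun i j => if (i : ℕ) < N then P X i j else Q Y i j with hM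
  set η : ℝ := 1 / 2 * q ^ (-(ρ : ℝ) / 3) with hη
  have hη0 : 0 < η := by positivity
  have hlow : ∀ X Y, (X + Y).rank = ρ → 2 * A.outputProb (M X Y) {1} - 1 ≤ -η := by
    intro X Y hXY
    have h1 : rankProblem n (h + ρ) (h + N) (M X Y) = some (-1) := by
      rw [rankProblem, if_pos]
      rw [hM, hPQ, hXY]
    have h2 := hA _ _ h1
    rw [A.outputProb_neg_one] at h2
    rw [hη]
    linarith
  have hhigh : ∀ X Y, (X + Y).rank = N → η ≤ 2 * A.outputProb (M X Y) {1} - 1 := by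
    intro X Y hXY
    have hr : (M X Y).rank = h + N := by rw [hM, hPQ, hXY]
    have h1 : rankProblem n (h + ρ) (h + N) (M X Y) = some 1 := by
      rw [rankProblem, if_neg (by omega), if_pos hr]
    have h2 := hA _ _ h1
    rw [hη]
    linarith
  -- A constant output distribution cannot have positive advantage. The numerical bound needs `s * k
  -- ≥ 1` when `ρ * log q` is small.
  have hsk : 1 ≤ s * k := by
    rw [Nat.one_le_iff_ne_zero]
    intro h0
    obtain ⟨C, hC⟩ := exists_rank_eq F (show ρ ≤ N by omega)
    obtain ⟨C', hC'⟩ := exists_rank_eq F (le_refl N)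
    have h1 := hlow C 0 (by rwa [add_zero])
    have h2 := hhigh C' 0 (by rwa [add_zero])
    rw [A.outputProb_eq_of_mul_eq_zero h0 (M C 0) (M C' 0)] at h1
    linarith
  have hadv := advantage_le_of_rectangles hρ1 (show ρ < N by omega)
    (fun X Y => 2 * A.outputProb (M X Y) {1} - 1)
    (fun X Y => abs_le.2 ⟨by linarith [A.outputProb_nonneg (M X Y) {1}],
      by linarith [A.outputProb_le_one (M X Y) {1}]⟩) η hη0.le hlow hhigh (2 ^ (2 * (s * k)))
    (fun Φ D hD => A.abs_sum_mul_outputProb_le N P Q Φ D hD)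
  have hfin := mul_sq_logb_le_of_advantage hq2 hρ1 hsk hadv
  rwa [Nat.cast_mul] at hfin

end RandStreamAlg

/-! ### The three lower bounds -/

theorem theorem1p3 :
    -- distinguishing rank `r` from rank `R`
    (∃ c : ℝ, 0 < c ∧
      ∀ (F : Type u) [Field F] [Fintype F] (n r R k s : ℕ) (A : RandStreamAlg.{u, 0, w} F n k s ℤˣ),
        (n : ℝ) / 2 ≤ r → r < R → R ≤ n →
        A.ComputesWithError (rankProblem n r R)
          (1 / 2 - 1 / 4 * (Fintype.card F : ℝ) ^ (-((r : ℝ) - (⌈(n : ℝ) / 2⌉₊ : ℝ)) / 3)) →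
        c * (((r : ℝ) - (⌈(n : ℝ) / 2⌉₊ : ℝ)) ^ 2 * Real.logb 2 (Fintype.card F))
          ≤ (s : ℝ) * (k : ℝ)) ∧
    -- distinguishing rank `⌊δ n⌋` from rank `n`
    (∀ δ : ℝ, 1 / 2 < δ → δ < 1 → ∃ c : ℝ, 0 < c ∧
      ∀ (F : Type u) [Field F] [Fintype F] (n k s : ℕ) (A : RandStreamAlg.{u, 0, w} F n k s ℤˣ),
        5 / (δ - 1 / 2) ≤ (n : ℝ) →
        A.ComputesWithError (rankProblem n ⌊δ * (n : ℝ)⌋₊ n)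
          (1 - (1 / 2 + (Fintype.card F : ℝ) ^ (-((δ - 1 / 2) * (n : ℝ)) / 5))) →
        c * ((n : ℝ) ^ 2 * Real.logb 2 (Fintype.card F)) ≤ (s : ℝ) * (k : ℝ)) ∧
    -- approximating the rank within a factor `a < √2`
    (∀ a : ℝ, 1 ≤ a → a < √2 → ∃ c : ℝ, 0 < c ∧
      ∀ (F : Type u) [Field F] [Fintype F] (n k s : ℕ) (A : RandStreamAlg.{u, 0, w} F n k s ℝ),
        40 / (2 - a ^ 2) ≤ (n : ℝ) →
        A.ApproximatesRank a
          (1 / 2 + (Fintype.card F : ℝ) ^ (-((2 - a ^ 2) * (n : ℝ)) / 40)) →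
        c * ((n : ℝ) ^ 2 * Real.logb 2 (Fintype.card F)) ≤ (s : ℝ) * (k : ℝ)) := by
  refine ⟨⟨1 / 1764, by norm_num, fun F _ _ n r R k s A h1 h2 h3 hA =>
    A.mul_sq_logb_le_of_computesWithError h1 h2 h3 hA⟩, fun δ hδ hδ1 => ?_, fun a ha ha2 => ?_⟩
  · have hδ0 : 0 < δ - 1 / 2 := by linarith
    refine ⟨1 / 1764 * (9 / 25 * (δ - 1 / 2) ^ 2), by positivity, fun F _ _ n k s A hn hA => ?_⟩
    have hq1 : (1 : ℝ) < Fintype.card F := one_lt_card_real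
    have hx : 5 ≤ (δ - 1 / 2) * n := by rwa [div_le_iff₀ hδ0, mul_comm] at hn
    have hn0 : (0 : ℝ) < n := lt_of_lt_of_le (by positivity) hn
    have hfl := Nat.lt_floor_add_one (δ * (n : ℝ))
    have hfl2 : (⌊δ * (n : ℝ)⌋₊ : ℝ) ≤ δ * n := Nat.floor_le (by positivity)
    have hce := Nat.ceil_lt_add_one (show (0 : ℝ) ≤ n / 2 by positivity)
    have hce2 := Nat.le_ceil ((n : ℝ) / 2)
    set r := ⌊δ * (n : ℝ)⌋₊
    set h := ⌈(n : ℝ) / 2⌉₊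
    -- Rounding costs `2`, and `(δ - 1/2) * n ≥ 5` makes the remainder at least `3/5` of `(δ - 1/2)
    -- * n`. A third of that is the exponent `(δ - 1/2) * n / 5`.
    have hρ : (δ - 1 / 2) * n - 2 ≤ (r : ℝ) - h := by linarith
    have hrn : r < n := by
      have : (r : ℝ) < n := lt_of_le_of_lt hfl2 (mul_lt_of_lt_one_left hn0 hδ1)
      exact_mod_cast this
    have hmain := A.mul_sq_logb_le_of_computesWithError (R := n) (by linarith) hrn le_rfl
      (hA.mono ?_)
    · refine le_trans ?_ hmain
      have hL : 0 ≤ Real.logb 2 (Fintype.card F) := Real.logb_nonneg (by norm_num) hq1.le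
      have h9 : 9 / 25 * (δ - 1 / 2) ^ 2 * (n : ℝ) ^ 2 ≤ ((r : ℝ) - h) ^ 2 := by
        calc _ = (3 / 5 * ((δ - 1 / 2) * n)) ^ 2 := by ring
          _ ≤ _ := by gcongr; linarith
      calc _ = 1 / 1764 *
            ((9 / 25 * (δ - 1 / 2) ^ 2 * (n : ℝ) ^ 2) * Real.logb 2 (Fintype.card F)) := by ring
        _ ≤ _ := by gcongr
    · have h4 : (Fintype.card F : ℝ) ^ (-((r : ℝ) - h) / 3) ≤
          (Fintype.card F : ℝ) ^ (-((δ - 1 / 2) * (n : ℝ)) / 5) :=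
        Real.rpow_le_rpow_of_exponent_le hq1.le (by linarith)
      have h5 : 0 < (Fintype.card F : ℝ) ^ (-((r : ℝ) - h) / 3) := by positivity
      linarith
  · have ha0 : 0 < a := by linarith
    have ha2' : a ^ 2 < 2 := by
      calc a ^ 2 < √2 ^ 2 := by gcongr
        _ = 2 := Real.sq_sqrt (by norm_num)
    have hη0 : 0 < 2 - a ^ 2 := by linarith
    have ha1 : 1 ≤ a ^ 2 := one_le_pow₀ ha
    refine ⟨1 / 1764 * (1 / 25 * (2 - a ^ 2) ^ 2), by positivity, fun F _ _ n k s A hn hA => ?_⟩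
    have hq1 : (1 : ℝ) < Fintype.card F := one_lt_card_real
    have hy : 40 ≤ (2 - a ^ 2) * n := by rwa [div_le_iff₀ hη0, mul_comm] at hn
    have hn0 : (0 : ℝ) < n := lt_of_lt_of_le (by positivity) hn
    have hna : 0 < (n : ℝ) / a ^ 2 := by positivity
    have hce := Nat.ceil_lt_add_one (show (0 : ℝ) ≤ n / 2 by positivity)
    have hce2 := Nat.le_ceil ((n : ℝ) / 2)
    -- The largest integer `r` strictly below `n / a ^ 2`, so `a * r < n / a`: the admissible
    -- outputs for ranks `r` and `n` are disjoint, and thresholding at `a * r` separates them.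
    obtain ⟨r, hr⟩ := Nat.exists_eq_succ_of_ne_zero (Nat.ceil_pos.2 hna).ne'
    have hr1 := Nat.ceil_lt_add_one hna.le
    have hr2 := Nat.le_ceil ((n : ℝ) / a ^ 2)
    rw [hr, Nat.cast_succ] at hr1 hr2
    have hra : (r : ℝ) < n / a ^ 2 := by linarith
    set h := ⌈(n : ℝ) / 2⌉₊
    have hquot : (2 - a ^ 2) * n / 4 ≤ n / a ^ 2 - n / 2 := by
      have e : (n : ℝ) / a ^ 2 - n / 2 = (2 - a ^ 2) * n / (2 * a ^ 2) := by
        field_simp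
      rw [e]
      gcongr
      linarith
    -- Since `(2 - a ^ 2) * n ≥ 40`, subtracting `2` still leaves at least `(2 - a ^ 2) * n / 5`.
    have hρ : (2 - a ^ 2) * n / 4 - 2 ≤ (r : ℝ) - h := by linarith
    have hrn : r < n := by
      have : (r : ℝ) < n := hra.trans_le (div_le_self hn0.le ha1)
      exact_mod_cast this
    have harn : a * r < 1 / a * n := by
      rw [lt_div_iff₀ (by positivity)] at hra
      rw [one_div_mul_eq_div, lt_div_iff₀ ha0]
      linarith
    let g : ℝ → ℤˣ := fun x => if a * r < x then 1 else -1
    have hg : Measurable g := Measurable.ite measurableSet_Ioi measurable_const measurable_const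
    have hmain := (A.map g hg).mul_sq_logb_le_of_computesWithError (r := r) (R := n)
      (by linarith) hrn le_rfl ?_
    · refine le_trans ?_ hmain
      have hL : 0 ≤ Real.logb 2 (Fintype.card F) := Real.logb_nonneg (by norm_num) hq1.le
      have h9 : 1 / 25 * (2 - a ^ 2) ^ 2 * (n : ℝ) ^ 2 ≤ ((r : ℝ) - h) ^ 2 := by
        calc _ = (1 / 5 * ((2 - a ^ 2) * n)) ^ 2 := by ring
          _ ≤ _ := by gcongr; linarith
      calc _ = 1 / 1764 *
            ((1 / 25 * (2 - a ^ 2) ^ 2 * (n : ℝ) ^ 2) * Real.logb 2 (Fintype.card F)) := by ring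
        _ ≤ _ := by gcongr
    · have h4 : (Fintype.card F : ℝ) ^ (-((r : ℝ) - h) / 3) ≤
          (Fintype.card F : ℝ) ^ (-((2 - a ^ 2) * (n : ℝ)) / 40) :=
        Real.rpow_le_rpow_of_exponent_le hq1.le (by linarith)
      have h5 : 0 < (Fintype.card F : ℝ) ^ (-((r : ℝ) - h) / 3) := by positivity
      intro M b hM
      refine le_trans (by linarith) ((hA M).trans ?_)
      rw [RandStreamAlg.outputProb_map]
      refine A.outputProb_mono M fun x hx => ?_
      rw [Set.mem_preimage, Set.mem_singleton_iff]
      rw [rankProblem] at hM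
      split_ifs at hM with h6 h7
      · rw [h6] at hx
        rw [← Option.some_inj.1 hM]
        exact if_neg (not_lt.2 hx.2)
      · rw [h7] at hx
        rw [← Option.some_inj.1 hM]
        exact if_pos (harn.trans_le hx.1)
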